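/- For positive integers $p,q$ let $\mathcal Z_{p,q}$ be the dimension drop algebra, i.e. the C*-algebra of continuous functions $f\colon[0,1]\to\mathbb M_p\otimes\mathbb M_q$ with $f(0)\in\mathbb M_p\otimes 1$ and $f(1)\in 1\otimes\mathbb M_q$. Write $c(f(0))\in\mathbb M_p$ and $c(f(1))\in\mathbb M_q$ for the matrices with $f(0)=c(f(0))\otimes 1$ and $f(1)=1\otimes c(f(1))$. A normalized eigenvalue pattern of a unital $*$-homomorphism $\varphi\colon\mathcal Z_{p,q}\to\mathcal Z_{p',q'}$ is a finite family of continuous maps $t_1\le\dots\le t_k$ from $[0,1]$ to $[0,1]$ such that, for some integers $0\le a<q$, $0\le b<p$ and some unitary matrices $v_s$ ($s\in[0,1]$) of size $p'q'$, \[ \varphi(f)(s)=v_s\,\operatorname{diag}\bigl[\underbrace{c(f(0)),\dots,c(f(0))}_{a},\,f(t_1(s)),\dots,f(t_k(s)),\,\underbrace{c(f(1)),\dots,c(f(1))}_{b}\bigr]\,v_s^* \] for all $f\in\mathcal Z_{p,q}$ and $s\in[0,1]$. Let $(\iota_{n,m}\colon\mathcal Z_{p_m,q_m}\to\mathcal Z_{p_n,q_n})_{m\le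 n}$ be an inductive sequence of dimension drop algebras with $p_n,q_n$ positive and coprime for every $n$, whose connecting maps are unital $*$-homomorphisms; assume that $\iota_{n,m}$ is injective whenever $p_m=1$ or $q_m=1$. Let $\mathcal Z_0$ be its C*-algebraic inductive limit. Then every $\iota_{n,m}$ has a normalized eigenvalue pattern $t^{m,n}_1\le\dots\le t^{m,n}_{k(m,n)}$, and for such patterns the following two conditions are equivalent. 1. The C*-algebra $\mathcal Z_0$ is simple. 2. For every $\varepsilon>0$, every $y\in[0,1]$ and every $m$, there exists $n>m$ such that for every $x\in[0,1]$ with $t^{m,n}_i(x)=y$ for some $i$, the Hausdorff distance between $\{t^{m,n}_1(x),\dots,t^{m,n}_{k(m,n)}(x)\}$ and $[0,1]$ is less than $\varepsilon$. -/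

import Mathlib

open scoped Matrix Kronecker Matrix.Norms.L2Operator

/-! ### Dimension drop algebras -/

/-- The dimension drop algebra `Z_{p,q}`: continuous functions `f` from `[0,1]` to
`M_p ⊗ M_q` (matrices indexed by `Fin p × Fin q`, with the operator norm) such that
`f 0 ∈ M_p ⊗ 1` and `f 1 ∈ 1 ⊗ M_q`. -/
noncomputable def dimensionDrop (p q : ℕ) :
    StarSubalgebra ℂ C(unitInterval, Matrix (Fin p × Fin q) (Fin p × Fin q) ℂ) where
  carrier := {f | (∃ a : Matrix (Fin p) (Fin p) ℂ, f 0 = a ⊗ₖ (1 : Matrix (Fin q) (Fin q) ℂ)) ∧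
    (∃ b : Matrix (Fin q) (Fin q) ℂ, f 1 = (1 : Matrix (Fin p) (Fin p) ℂ) ⊗ₖ b)}
  mul_mem' := by
    rintro f g ⟨⟨a, ha⟩, ⟨b, hb⟩⟩ ⟨⟨a', ha'⟩, ⟨b', hb'⟩⟩
    refine ⟨⟨a * a', ?_⟩, ⟨b * b', ?_⟩⟩
    · rw [ContinuousMap.mul_apply, ha, ha', ← Matrix.mul_kronecker_mul, one_mul]
    · rw [ContinuousMap.mul_apply, hb, hb', ← Matrix.mul_kronecker_mul, one_mul]
  add_mem' := by
    rintro f g ⟨⟨a, ha⟩, ⟨b, hb⟩⟩ ⟨⟨a', ha'⟩, ⟨b', hb'⟩⟩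
    refine ⟨⟨a + a', ?_⟩, ⟨b + b', ?_⟩⟩
    · rw [ContinuousMap.add_apply, ha, ha', Matrix.add_kronecker]
    · rw [ContinuousMap.add_apply, hb, hb', Matrix.kronecker_add]
  algebraMap_mem' := by
    intro r
    refine ⟨⟨r • 1, ?_⟩, ⟨r • 1, ?_⟩⟩
    · rw [Matrix.smul_kronecker, Matrix.one_kronecker_one]; exact Algebra.algebraMap_eq_smul_one r
    · rw [Matrix.kronecker_smul, Matrix.one_kronecker_one]; exact Algebra.algebraMap_eq_smul_one r
  star_mem' := by
    rintro f ⟨⟨a, ha⟩, ⟨b, hb⟩⟩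
    refine ⟨⟨aᴴ, ?_⟩, ⟨bᴴ, ?_⟩⟩
    · rw [ContinuousMap.star_apply, ha, Matrix.star_eq_conjTranspose,
        Matrix.conjTranspose_kronecker, Matrix.conjTranspose_one]
    · rw [ContinuousMap.star_apply, hb, Matrix.star_eq_conjTranspose,
        Matrix.conjTranspose_kronecker, Matrix.conjTranspose_one]

instance dimensionDrop_isClosed (p q : ℕ) :
    IsClosed (dimensionDrop p q :
      Set C(unitInterval, Matrix (Fin p × Fin q) (Fin p × Fin q) ℂ)) := by
  have h0 : IsClosed {M : Matrix (Fin p × Fin q) (Fin p × Fin q) ℂ |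
      ∃ a : Matrix (Fin p) (Fin p) ℂ, M = a ⊗ₖ (1 : Matrix (Fin q) (Fin q) ℂ)} := by
    have := (LinearMap.range ((Matrix.kroneckerMapBilinear (LinearMap.mul ℂ ℂ) :
      Matrix (Fin p) (Fin p) ℂ →ₗ[ℂ] Matrix (Fin q) (Fin q) ℂ →ₗ[ℂ] _).flip 1)).closed_of_finiteDimensional
    convert this using 1
    ext M
    simp only [Set.mem_ofPred_eq, SetLike.mem_coe, LinearMap.mem_range]
    exact exists_congr fun a => eq_comm
  have h1 : IsClosed {M : Matrix (Fin p × Fin q) (Fin p × Fin q) ℂ |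
      ∃ b : Matrix (Fin q) (Fin q) ℂ, M = (1 : Matrix (Fin p) (Fin p) ℂ) ⊗ₖ b} := by
    have := (LinearMap.range ((Matrix.kroneckerMapBilinear (LinearMap.mul ℂ ℂ) :
      Matrix (Fin p) (Fin p) ℂ →ₗ[ℂ] Matrix (Fin q) (Fin q) ℂ →ₗ[ℂ] _) 1)).closed_of_finiteDimensional
    convert this using 1
    ext M
    simp only [Set.mem_ofPred_eq, SetLike.mem_coe, LinearMap.mem_range]
    exact exists_congr fun a => eq_comm
  exact (h0.preimage (continuous_eval_const (0 : unitInterval))).inter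
    (h1.preimage (continuous_eval_const (1 : unitInterval)))

/-! ### Eigenvalue patterns -/

/-- The map `c : M_p ⊗ 1_q → M_p`, `a ⊗ 1 ↦ a` (extended to all of `M_p ⊗ M_q` as the normalized
partial trace). -/
noncomputable def leftFactor {p q : ℕ} (M : Matrix (Fin p × Fin q) (Fin p × Fin q) ℂ) :
    Matrix (Fin p) (Fin p) ℂ :=
  Matrix.of fun i j => (q : ℂ)⁻¹ * ∑ l, M (i, l) (j, l)

/-- The map `c : 1_p ⊗ M_q → M_q`, `1 ⊗ b ↦ b` (extended to all of `M_p ⊗ M_q` as the normalized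
partial trace). -/
noncomputable def rightFactor {p q : ℕ} (M : Matrix (Fin p × Fin q) (Fin p × Fin q) ℂ) :
    Matrix (Fin q) (Fin q) ℂ :=
  Matrix.of fun i j => (p : ℂ)⁻¹ * ∑ l, M (l, i) (l, j)

theorem leftFactor_kronecker_one {p q : ℕ} (hq : 0 < q) (a : Matrix (Fin p) (Fin p) ℂ) :
    leftFactor (a ⊗ₖ (1 : Matrix (Fin q) (Fin q) ℂ)) = a := by
  ext i j
  have : (q : ℂ) ≠ 0 := by exact_mod_cast hq.ne'
  simp [leftFactor]
  field_simp

theorem rightFactor_one_kronecker {p q : ℕ} (hp : 0 < p) (b : Matrix (Fin q) (Fin q) ℂ) :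
    rightFactor ((1 : Matrix (Fin p) (Fin p) ℂ) ⊗ₖ b) = b := by
  ext i j
  have : (p : ℂ) ≠ 0 := by exact_mod_cast hp.ne'
  simp [rightFactor]
  field_simp

/-- The block diagonal matrix
`diag[c(f 0), …, c(f 0), f (t_1 s), …, f (t_k s), c(f 1), …, c(f 1)]`,
with `a` blocks `c(f 0)` and `b` blocks `c(f 1)`. -/
noncomputable def patternMatrix {p q k : ℕ} (a b : ℕ)
    (t : Fin k → C(unitInterval, unitInterval)) (f : dimensionDrop p q) (s : unitInterval) :
    Matrix ((Fin p × Fin a) ⊕ (((Fin p × Fin q) × Fin k) ⊕ (Fin q × Fin b)))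
      ((Fin p × Fin a) ⊕ (((Fin p × Fin q) × Fin k) ⊕ (Fin q × Fin b))) ℂ :=
  Matrix.fromBlocks (Matrix.blockDiagonal fun _ : Fin a => leftFactor (f.1 0)) 0 0
    (Matrix.fromBlocks (Matrix.blockDiagonal fun i : Fin k => f.1 (t i s)) 0 0
      (Matrix.blockDiagonal fun _ : Fin b => rightFactor (f.1 1)))

/-- `t_1, …, t_k` is an eigenvalue pattern of `φ : Z_{p,q} → Z_{p',q'}`: there are remainder
indices `0 ≤ a < q`, `0 ≤ b < p` and unitaries `v_s` such that
`φ(f)(s) = v_s diag[c(f 0), …, f (t_1 s), …, f (t_k s), …, c(f 1)] v_s^*` for all `f` and `s`.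
The bijection `e` identifies the index set of the block diagonal matrix with that of
`M_{p'} ⊗ M_{q'}`. -/
def IsEigenvaluePattern {p q p' q' k : ℕ} (φ : dimensionDrop p q →⋆ₐ[ℂ] dimensionDrop p' q')
    (t : Fin k → C(unitInterval, unitInterval)) : Prop :=
  ∃ a b : ℕ, a < q ∧ b < p ∧
    ∃ (e : (Fin p × Fin a) ⊕ (((Fin p × Fin q) × Fin k) ⊕ (Fin q × Fin b)) ≃ Fin p' × Fin q')
      (v : unitInterval → Matrix.unitaryGroup (Fin p' × Fin q') ℂ),
      ∀ (f : dimensionDrop p q) (s : unitInterval),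
        (φ f).1 s = (v s : Matrix (Fin p' × Fin q') (Fin p' × Fin q') ℂ) *
          Matrix.reindex e e (patternMatrix a b t f s) *
            (v s : Matrix (Fin p' × Fin q') (Fin p' × Fin q') ℂ)ᴴ

/-- An eigenvalue pattern is normalized if `t_1 ≤ ⋯ ≤ t_k` pointwise. -/
def IsNormalizedEigenvaluePattern {p q p' q' k : ℕ}
    (φ : dimensionDrop p q →⋆ₐ[ℂ] dimensionDrop p' q')
    (t : Fin k → C(unitInterval, unitInterval)) : Prop :=
  IsEigenvaluePattern φ t ∧ Monotone t

/-! ### Inductive limits of C⋆-algebras -/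

section Limit

variable {A : ℕ → Type*} [∀ n, CStarAlgebra (A n)]
  (ι : ∀ m n, m ≤ n → A m →⋆ₐ[ℂ] A n) [DirectedSystem A (ι · · ·)]

/-- The algebraic direct limit of an inductive sequence of C⋆-algebras. -/
def AlgLimit : Type _ := DirectLimit A ι

namespace AlgLimit

noncomputable instance : Ring (AlgLimit ι) := inferInstanceAs (Ring (DirectLimit A ι))

noncomputable instance : Algebra ℂ (AlgLimit ι) := inferInstanceAs (Algebra ℂ (DirectLimit A ι))

noncomputable instance : Star (AlgLimit ι) := inferInstanceAs (Star (DirectLimit A ι))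

/-- The class in the algebraic direct limit of an element of `A n`. -/
def mk (n : ℕ) (a : A n) : AlgLimit ι := (⟦⟨n, a⟩⟧ : DirectLimit A ι)

theorem mk_map (m n : ℕ) (h : m ≤ n) (a : A m) : mk ι n (ι m n h a) = mk ι m a :=
  DirectLimit.mk_apply _ _ _ _

theorem mk_add (n : ℕ) (a b : A n) : mk ι n a + mk ι n b = mk ι n (a + b) :=
  DirectLimit.add_def _ _ _

theorem mk_mul (n : ℕ) (a b : A n) : mk ι n a * mk ι n b = mk ι n (a * b) :=
  DirectLimit.mul_def _ _ _

theorem mk_neg (n : ℕ) (a : A n) : -mk ι n a = mk ι n (-a) := rfl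

theorem mk_zero (n : ℕ) : mk ι n 0 = 0 := (DirectLimit.zero_def n).symm

theorem mk_smul (n : ℕ) (r : ℂ) (a : A n) : r • mk ι n a = mk ι n (r • a) :=
  DirectLimit.smul_def _ _ _

theorem star_mk (n : ℕ) (a : A n) : star (mk ι n a) = mk ι n (star a) := rfl

theorem exists_mk (x : AlgLimit ι) : ∃ n a, mk ι n a = x := by
  obtain ⟨n, a, h⟩ := DirectLimit.exists_eq_mk _ x
  exact ⟨n, a, h.symm⟩

theorem exists_mk₂ (x y : AlgLimit ι) : ∃ n a b, mk ι n a = x ∧ mk ι n b = y := by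
  obtain ⟨n, a, b, h, h'⟩ := DirectLimit.exists_eq_mk₂ _ x y
  exact ⟨n, a, b, h.symm, h'.symm⟩

theorem mk_eq_mk {m n : ℕ} {a : A m} {b : A n} :
    mk ι m a = mk ι n b ↔ ∃ (l : ℕ) (h : m ≤ l) (h' : n ≤ l), ι m l h a = ι n l h' b :=
  Quotient.eq

/-- The C⋆-seminorm of the algebraic direct limit, the infimum of the norms of all representatives;
since the connecting maps are contractive, the seminorm of the class of `a ∈ A m` is
`lim_n ‖ι m n a‖`. -/
noncomputable instance : Norm (AlgLimit ι) where
  norm x := sInf {r : ℝ | ∃ (n : ℕ) (a : A n), mk ι n a = x ∧ r = ‖a‖}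

theorem norm_mk_le (n : ℕ) (a : A n) : ‖mk ι n a‖ ≤ ‖a‖ :=
  csInf_le ⟨0, by rintro _ ⟨n, a, -, rfl⟩; exact norm_nonneg a⟩ ⟨n, a, rfl, rfl⟩

theorem le_norm {x : AlgLimit ι} {c : ℝ} (h : ∀ n a, mk ι n a = x → c ≤ ‖a‖) : c ≤ ‖x‖ := by
  obtain ⟨n, a, hx⟩ := exists_mk ι x
  exact le_csInf ⟨_, n, a, hx, rfl⟩ (by rintro _ ⟨n, a, hx, rfl⟩; exact h n a hx)

theorem norm_nonneg' (x : AlgLimit ι) : 0 ≤ ‖x‖ := le_norm ι fun _ a _ => norm_nonneg a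

theorem exists_norm_lt {x : AlgLimit ι} {c : ℝ} (h : ‖x‖ < c) : ∃ n a, mk ι n a = x ∧ ‖a‖ < c := by
  by_contra! H
  exact absurd (le_norm ι H) (not_le.2 h)

theorem exists_norm_lt₂ {x y : AlgLimit ι} {c d : ℝ} (h : ‖x‖ < c) (h' : ‖y‖ < d) :
    ∃ n a b, mk ι n a = x ∧ mk ι n b = y ∧ ‖a‖ < c ∧ ‖b‖ < d := by
  obtain ⟨m, a, rfl, ha⟩ := exists_norm_lt ι h
  obtain ⟨n, b, rfl, hb⟩ := exists_norm_lt ι h'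
  exact ⟨max m n, ι _ _ (le_max_left _ _) a, ι _ _ (le_max_right _ _) b, mk_map .., mk_map ..,
    (NonUnitalStarAlgHom.norm_apply_le _ a).trans_lt ha,
    (NonUnitalStarAlgHom.norm_apply_le _ b).trans_lt hb⟩

theorem norm_smul_le' (r : ℂ) (x : AlgLimit ι) : ‖r • x‖ ≤ ‖r‖ * ‖x‖ := by
  refine le_of_forall_pos_lt_add fun ε hε => ?_
  obtain ⟨n, a, rfl, ha⟩ := exists_norm_lt ι
    (show ‖x‖ < ‖x‖ + ε / (‖r‖ + 1) by have : 0 < ε / (‖r‖ + 1) := by positivity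
                                       linarith)
  rw [mk_smul]
  calc ‖mk ι n (r • a)‖ ≤ ‖r‖ * ‖a‖ := (norm_mk_le ι n _).trans (norm_smul_le r a)
    _ ≤ ‖r‖ * (‖mk ι n a‖ + ε / (‖r‖ + 1)) := by gcongr
    _ = ‖r‖ * ‖mk ι n a‖ + ε * (‖r‖ / (‖r‖ + 1)) := by ring
    _ < ‖r‖ * ‖mk ι n a‖ + ε := by
      have : ‖r‖ / (‖r‖ + 1) < 1 := by rw [div_lt_one (by positivity)]; linarith
      have := mul_lt_mul_of_pos_left this hε
      linarith

noncomputable instance : SeminormedRing (AlgLimit ι) where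
  __ := (inferInstance : Ring (AlgLimit ι))
  __ := SeminormedAddCommGroup.ofCore (𝕜 := ℂ) (E := AlgLimit ι)
    { norm_nonneg := norm_nonneg' ι
      norm_smul := fun r x => by
        refine le_antisymm (norm_smul_le' ι r x) ?_
        rcases eq_or_ne r 0 with rfl | hr
        · simpa using norm_nonneg' ι _
        · have := norm_smul_le' ι r⁻¹ (r • x)
          rw [inv_smul_smul₀ hr, norm_inv] at this
          rwa [← le_inv_mul_iff₀ (norm_pos_iff.2 hr)]
      norm_triangle := fun x y => by
        refine le_of_forall_pos_le_add fun ε hε => ?_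
        obtain ⟨n, a, b, rfl, rfl, ha, hb⟩ := exists_norm_lt₂ ι
          (lt_add_of_pos_right ‖x‖ (half_pos hε)) (lt_add_of_pos_right ‖y‖ (half_pos hε))
        rw [mk_add]
        have := (norm_mk_le ι n (a + b)).trans (norm_add_le a b)
        linarith }
  norm_mul_le x y := by
    refine le_mul_of_forall_lt₀ fun c hc d hd => ?_
    obtain ⟨n, a, b, rfl, rfl, ha, hb⟩ := exists_norm_lt₂ ι hc hd
    rw [mk_mul]
    calc ‖mk ι n (a * b)‖ ≤ ‖a‖ * ‖b‖ := (norm_mk_le ι n _).trans (norm_mul_le a b)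
      _ ≤ c * d := by
        have := (norm_nonneg a).trans ha.le
        gcongr

noncomputable instance : NormedAlgebra ℂ (AlgLimit ι) where
  norm_smul_le := norm_smul_le' ι

noncomputable instance : StarRing (AlgLimit ι) where
  star_involutive x := by
    obtain ⟨n, a, rfl⟩ := exists_mk ι x
    rw [star_mk, star_mk, star_star]
  star_mul x y := by
    obtain ⟨n, a, b, rfl, rfl⟩ := exists_mk₂ ι x y
    rw [mk_mul, star_mk, star_mk, star_mk, mk_mul, star_mul]
  star_add x y := by
    obtain ⟨n, a, b, rfl, rfl⟩ := exists_mk₂ ι x y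
    rw [mk_add, star_mk, star_mk, star_mk, mk_add, star_add]

instance : StarModule ℂ (AlgLimit ι) where
  star_smul r x := by
    obtain ⟨n, a, rfl⟩ := exists_mk ι x
    rw [mk_smul, star_mk, star_mk, mk_smul, star_smul]

theorem norm_mul_self_le (x : AlgLimit ι) : ‖x‖ * ‖x‖ ≤ ‖star x * x‖ := by
  refine le_norm ι fun n b hb => ?_
  obtain ⟨m, a, rfl⟩ := exists_mk ι x
  rw [star_mk, mk_mul, mk_eq_mk] at hb
  obtain ⟨l, h, h', hl⟩ := hb
  rw [← mk_map ι m l h' a]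
  calc ‖mk ι l (ι m l h' a)‖ * ‖mk ι l (ι m l h' a)‖
      ≤ ‖ι m l h' a‖ * ‖ι m l h' a‖ := by gcongr <;> exact norm_mk_le ι l _
    _ = ‖ι n l h b‖ := by rw [hl, map_mul, map_star, CStarRing.norm_star_mul_self]
    _ ≤ ‖b‖ := NonUnitalStarAlgHom.norm_apply_le _ b

instance : NormedStarGroup (AlgLimit ι) where
  norm_star_le x := by
    refine le_norm ι fun n a ha => ?_
    rw [← ha, star_mk]
    exact (norm_mk_le ι n _).trans (norm_star a).le

end AlgLimit

/-- The inductive limit of an inductive sequence of C⋆-algebras: the completion of the algebraic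
direct limit in its C⋆-seminorm. -/
def CStarLimit (A : ℕ → Type*) [∀ n, CStarAlgebra (A n)]
    (ι : ∀ m n, m ≤ n → A m →⋆ₐ[ℂ] A n) [DirectedSystem A (ι · · ·)] : Type _ := UniformSpace.Completion (AlgLimit ι)

namespace CStarLimit

noncomputable instance : NormedRing (CStarLimit A ι) :=
  inferInstanceAs (NormedRing (UniformSpace.Completion (AlgLimit ι)))

noncomputable instance : Algebra ℂ (CStarLimit A ι) :=
  inferInstanceAs (Algebra ℂ (UniformSpace.Completion (AlgLimit ι)))

noncomputable instance : NormedAlgebra ℂ (CStarLimit A ι) where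
  norm_smul_le r x :=
    norm_smul_le (α := ℂ) (β := UniformSpace.Completion (AlgLimit ι)) r x

instance : CompleteSpace (CStarLimit A ι) :=
  inferInstanceAs (CompleteSpace (UniformSpace.Completion (AlgLimit ι)))

/-- The canonical map from the algebraic direct limit to the inductive limit. -/
noncomputable def coe (x : AlgLimit ι) : CStarLimit A ι := (x : UniformSpace.Completion (AlgLimit ι))

noncomputable instance : Star (CStarLimit A ι) where
  star := UniformSpace.Completion.map (star : AlgLimit ι → AlgLimit ι)

theorem star_coe (x : AlgLimit ι) : star (coe ι x) = coe ι (star x) :=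
  UniformSpace.Completion.map_coe star_isometry.uniformContinuous x

theorem continuous_star' : Continuous (star : CStarLimit A ι → CStarLimit A ι) :=
  UniformSpace.Completion.continuous_map

theorem denseRange_coe : DenseRange (coe ι) := UniformSpace.Completion.denseRange_coe

theorem coe_mul (x y : AlgLimit ι) : coe ι (x * y) = coe ι x * coe ι y :=
  UniformSpace.Completion.coe_mul x y

theorem coe_add (x y : AlgLimit ι) : coe ι (x + y) = coe ι x + coe ι y :=
  UniformSpace.Completion.coe_add x y

theorem coe_smul (r : ℂ) (x : AlgLimit ι) : coe ι (r • x) = r • coe ι x :=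
  UniformSpace.Completion.coe_smul r x

theorem norm_coe (x : AlgLimit ι) : ‖coe ι x‖ = ‖x‖ := UniformSpace.Completion.norm_coe x

noncomputable instance : CStarAlgebra (CStarLimit A ι) where
  star_involutive x := (denseRange_coe ι).induction_on
    (p := fun x => star (star x) = x) x
    (isClosed_eq ((continuous_star' ι).comp (continuous_star' ι)) continuous_id)
    fun x => by rw [star_coe, star_coe, star_star]
  star_mul x y := (denseRange_coe ι).induction_on₂
    (p := fun x y => star (x * y) = star y * star x)
    (isClosed_eq ((continuous_star' ι).comp continuous_mul)
      (((continuous_star' ι).comp continuous_snd).mul ((continuous_star' ι).comp continuous_fst)))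
    (fun x y => by rw [← coe_mul, star_coe, star_coe, star_coe, ← coe_mul, star_mul]) x y
  star_add x y := (denseRange_coe ι).induction_on₂
    (p := fun x y => star (x + y) = star x + star y)
    (isClosed_eq ((continuous_star' ι).comp continuous_add)
      (((continuous_star' ι).comp continuous_fst).add ((continuous_star' ι).comp continuous_snd)))
    (fun x y => by rw [← coe_add, star_coe, star_coe, star_coe, ← coe_add, star_add]) x y
  star_smul r x := (denseRange_coe ι).induction_on
    (p := fun x => star (r • x) = star r • star x) x
    (isClosed_eq ((continuous_star' ι).comp (continuous_const_smul r))
      ((continuous_const_smul (star r)).comp (continuous_star' ι)))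
    fun x => by rw [← coe_smul, star_coe, star_coe, ← coe_smul, star_smul]
  norm_mul_self_le x := (denseRange_coe ι).induction_on
    (p := fun x => ‖x‖ * ‖x‖ ≤ ‖star x * x‖) x
    (isClosed_le (continuous_norm.mul continuous_norm)
      (continuous_norm.comp ((continuous_star' ι).mul continuous_id)))
    fun x => by
      rw [star_coe, ← coe_mul, norm_coe, norm_coe]
      exact AlgLimit.norm_mul_self_le ι x

end CStarLimit

end Limit

/-- A C⋆-algebra is simple if it is nonzero and has no closed two-sided ideals besides
`0` and itself. -/
def IsSimpleCStarAlgebra (B : Type*) [CStarAlgebra B] : Prop :=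
  Nontrivial B ∧ ∀ I : TwoSidedIdeal B, IsClosed (I : Set B) → I = ⊥ ∨ I = ⊤

/-! Existence of patterns. For each `s` the map `f ↦ (φ f).1 s` is a finite-dimensional
representation of `Z_{p,q}`, hence a direct sum of irreducible ones: `M_p` at the left end, `M_p ⊗
M_q` at interior points, `M_q` at the right end. Grouping `q` copies of the left end into an
evaluation at `0`, and `p` copies of the right end into an evaluation at `1`, leaves `a < q` and `b
< p`. By coprimality the size `p'q' = pa + pqk + qb` then determines `(a, b, k)`, so these numbers
do not depend on `s`. Traces of images of scalar functions are continuous in `s`, which makes the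
sorted eigenvalues continuous; the unitaries need no continuity.

Injectivity. If `p, q ≥ 2` and the eigenvalue functions miss an interior point, cutting there gives
projections in the target whose trace is not a multiple of `p'q'`. A dimension drop algebra with
coprime sizes has no such projection (`mul_dvd_of_trace_eq`). So all connecting maps are injective,
therefore isometric, and the limit norm can be computed at finite stages.

Simplicity implies density. If density fails at every later stage, there are points `x_n` whose
eigenvalues all avoid a fixed distance from some `z_n`. Along a subsequence with `z_n → z₀`, the
elements vanishing asymptotically at the `x_n` generate a closed ideal. It contains a bump at `z₀`
but stays away from `1`.

Density implies simplicity. A closed ideal has at each stage a hull in `[0,1]`, which determines it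
there. The eigenvalue functions carry later hulls into earlier ones and reach every interior point
of the earlier ones, so under the density condition an interior hull point forces the whole interval
as hull. A proper nonzero ideal therefore has, at all late stages, a nonempty hull inside `{0,1}`.
Density at `y = 0` and at `y = 1` makes all eigenvalues over the hull equal to `1` at one stage and
to `0` at another. Comparing traces at the later of the two stages contradicts `a < q` or `b < p`.
-/

namespace DimensionDrop

variable {p q : ℕ}

/-! ### Point evaluations and irreducible representations. -/

theorem ext' {f g : dimensionDrop p q} (h : ∀ s, f.1 s = g.1 s) : f = g :=
  Subtype.ext (ContinuousMap.ext h)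

@[simp] theorem coe_add (f g : dimensionDrop p q) (s) : (f + g).1 s = f.1 s + g.1 s := rfl
@[simp] theorem coe_sub (f g : dimensionDrop p q) (s) : (f - g).1 s = f.1 s - g.1 s := rfl
@[simp] theorem coe_mul (f g : dimensionDrop p q) (s) : (f * g).1 s = f.1 s * g.1 s := rfl
@[simp] theorem coe_smul (r : ℂ) (f : dimensionDrop p q) (s) : (r • f).1 s = r • f.1 s := rfl
@[simp] theorem coe_zero (s) : (0 : dimensionDrop p q).1 s = 0 := rfl
@[simp] theorem coe_one (s) : (1 : dimensionDrop p q).1 s = 1 := rfl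
@[simp] theorem coe_star (f : dimensionDrop p q) (s) : (star f).1 s = (f.1 s)ᴴ := rfl

theorem coe_sum {ι : Type*} (S : Finset ι) (f : ι → dimensionDrop p q) (s) :
    (∑ i ∈ S, f i).1 s = ∑ i ∈ S, (f i).1 s := by
  classical
  induction S using Finset.induction_on with
  | empty => simp
  | insert a S ha ih => rw [Finset.sum_insert ha, Finset.sum_insert ha, coe_add, ih]

theorem norm_apply_le (f : dimensionDrop p q) (s) : ‖f.1 s‖ ≤ ‖f‖ := f.1.norm_coe_le_norm s

theorem norm_le {f : dimensionDrop p q} {C : ℝ} (hC : 0 ≤ C) (h : ∀ s, ‖f.1 s‖ ≤ C) : ‖f‖ ≤ C :=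
  (ContinuousMap.norm_le _ hC).2 h

/-- The element `s ↦ h s • M` of the dimension drop algebra. -/
noncomputable def smulConst (h : C(unitInterval, ℂ)) (M : Matrix (Fin p × Fin q) (Fin p × Fin q) ℂ)
    (h0 : ∃ a : Matrix (Fin p) (Fin p) ℂ, h 0 • M = a ⊗ₖ (1 : Matrix (Fin q) (Fin q) ℂ))
    (h1 : ∃ b : Matrix (Fin q) (Fin q) ℂ, h 1 • M = (1 : Matrix (Fin p) (Fin p) ℂ) ⊗ₖ b) :
    dimensionDrop p q :=
  ⟨⟨fun s => h s • M, by fun_prop⟩, h0, h1⟩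

@[simp] theorem smulConst_apply (h : C(unitInterval, ℂ)) (M h0 h1 s) :
    (smulConst (p := p) (q := q) h M h0 h1).1 s = h s • M := rfl

/-- The scalar functions in the dimension drop algebra. -/
noncomputable def scalar (h : C(unitInterval, ℂ)) : dimensionDrop p q :=
  smulConst h 1 ⟨h 0 • 1, by rw [Matrix.smul_kronecker, Matrix.one_kronecker_one]⟩
    ⟨h 1 • 1, by rw [Matrix.kronecker_smul, Matrix.one_kronecker_one]⟩

@[simp] theorem scalar_apply (h : C(unitInterval, ℂ)) (s) :
    (scalar (p := p) (q := q) h).1 s = h s • 1 := rfl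

/-- Evaluation at a point, as a star homomorphism. -/
noncomputable def evalAt (s : unitInterval) :
    dimensionDrop p q →⋆ₐ[ℂ] Matrix (Fin p × Fin q) (Fin p × Fin q) ℂ where
  toFun f := f.1 s
  map_one' := rfl
  map_mul' _ _ := rfl
  map_zero' := rfl
  map_add' _ _ := rfl
  commutes' _ := rfl
  map_star' _ := rfl

@[simp] theorem evalAt_apply (s : unitInterval) (f : dimensionDrop p q) : evalAt s f = f.1 s := rfl

theorem apply_zero_eq (hq : 0 < q) (f : dimensionDrop p q) :
    f.1 0 = leftFactor (f.1 0) ⊗ₖ (1 : Matrix (Fin q) (Fin q) ℂ) := by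
  obtain ⟨a, ha⟩ := f.2.1
  rw [ha, leftFactor_kronecker_one hq]

theorem apply_one_eq (hp : 0 < p) (f : dimensionDrop p q) :
    f.1 1 = (1 : Matrix (Fin p) (Fin p) ℂ) ⊗ₖ rightFactor (f.1 1) := by
  obtain ⟨a, ha⟩ := f.2.2
  rw [ha, rightFactor_one_kronecker hp]

theorem leftFactor_add (M N : Matrix (Fin p × Fin q) (Fin p × Fin q) ℂ) :
    leftFactor (M + N) = leftFactor M + leftFactor N := by
  ext; simp [leftFactor, Finset.sum_add_distrib, mul_add]

theorem rightFactor_add (M N : Matrix (Fin p × Fin q) (Fin p × Fin q) ℂ) :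
    rightFactor (M + N) = rightFactor M + rightFactor N := by
  ext; simp [rightFactor, Finset.sum_add_distrib, mul_add]

@[simp] theorem leftFactor_zero :
    leftFactor (0 : Matrix (Fin p × Fin q) (Fin p × Fin q) ℂ) = 0 := by
  ext; simp [leftFactor]

@[simp] theorem rightFactor_zero :
    rightFactor (0 : Matrix (Fin p × Fin q) (Fin p × Fin q) ℂ) = 0 := by
  ext; simp [rightFactor]

theorem leftFactor_smul (r : ℂ) (M : Matrix (Fin p × Fin q) (Fin p × Fin q) ℂ) :
    leftFactor (r • M) = r • leftFactor M := by
  ext; simp [leftFactor, ← Finset.mul_sum]; ring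

theorem rightFactor_smul (r : ℂ) (M : Matrix (Fin p × Fin q) (Fin p × Fin q) ℂ) :
    rightFactor (r • M) = r • rightFactor M := by
  ext; simp [rightFactor, ← Finset.mul_sum]; ring

theorem leftFactor_one (hq : 0 < q) :
    leftFactor (1 : Matrix (Fin p × Fin q) (Fin p × Fin q) ℂ) = 1 := by
  rw [← Matrix.one_kronecker_one, leftFactor_kronecker_one hq]

theorem rightFactor_one (hp : 0 < p) :
    rightFactor (1 : Matrix (Fin p × Fin q) (Fin p × Fin q) ℂ) = 1 := by
  rw [← Matrix.one_kronecker_one, rightFactor_one_kronecker hp]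

/-- The irreducible representation of the dimension drop algebra at the left end point. -/
noncomputable def evalLeft (hq : 0 < q) : dimensionDrop p q →⋆ₐ[ℂ] Matrix (Fin p) (Fin p) ℂ where
  toFun f := leftFactor (f.1 0)
  map_one' := leftFactor_one hq
  map_mul' f g := by
    rw [coe_mul, apply_zero_eq hq f, apply_zero_eq hq g, ← Matrix.mul_kronecker_mul, one_mul,
      leftFactor_kronecker_one hq, leftFactor_kronecker_one hq, leftFactor_kronecker_one hq]
  map_zero' := leftFactor_zero
  map_add' _ _ := leftFactor_add _ _
  commutes' r := by
    rw [Algebra.algebraMap_eq_smul_one, coe_smul, leftFactor_smul, coe_one, leftFactor_one hq,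
      Algebra.algebraMap_eq_smul_one]
  map_star' f := by
    rw [coe_star, apply_zero_eq hq f, Matrix.conjTranspose_kronecker, Matrix.conjTranspose_one,
      leftFactor_kronecker_one hq, leftFactor_kronecker_one hq, Matrix.star_eq_conjTranspose]

/-- The irreducible representation of the dimension drop algebra at the right end point. -/
noncomputable def evalRight (hp : 0 < p) : dimensionDrop p q →⋆ₐ[ℂ] Matrix (Fin q) (Fin q) ℂ where
  toFun f := rightFactor (f.1 1)
  map_one' := rightFactor_one hp
  map_mul' f g := by
    rw [coe_mul, apply_one_eq hp f, apply_one_eq hp g, ← Matrix.mul_kronecker_mul, one_mul,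
      rightFactor_one_kronecker hp, rightFactor_one_kronecker hp, rightFactor_one_kronecker hp]
  map_zero' := rightFactor_zero
  map_add' _ _ := rightFactor_add _ _
  commutes' r := by
    rw [Algebra.algebraMap_eq_smul_one, coe_smul, rightFactor_smul, coe_one, rightFactor_one hp,
      Algebra.algebraMap_eq_smul_one]
  map_star' f := by
    rw [coe_star, apply_one_eq hp f, Matrix.conjTranspose_kronecker, Matrix.conjTranspose_one,
      rightFactor_one_kronecker hp, rightFactor_one_kronecker hp, Matrix.star_eq_conjTranspose]

@[simp] theorem evalLeft_apply (hq : 0 < q) (f : dimensionDrop p q) :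
    evalLeft hq f = leftFactor (f.1 0) := rfl

@[simp] theorem evalRight_apply (hp : 0 < p) (f : dimensionDrop p q) :
    evalRight hp f = rightFactor (f.1 1) := rfl

theorem evalLeft_eq_zero (hq : 0 < q) (f : dimensionDrop p q) :
    evalLeft hq f = 0 ↔ f.1 0 = 0 := by
  rw [evalLeft_apply]
  refine ⟨fun h => ?_, fun h => by rw [h, leftFactor_zero]⟩
  rw [apply_zero_eq hq f, h, Matrix.zero_kronecker]

theorem evalRight_eq_zero (hp : 0 < p) (f : dimensionDrop p q) :
    evalRight hp f = 0 ↔ f.1 1 = 0 := by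
  rw [evalRight_apply]
  refine ⟨fun h => ?_, fun h => by rw [h, rightFactor_zero]⟩
  rw [apply_one_eq hp f, h, Matrix.kronecker_zero]

/-- The coordinate function on the unit interval. -/
noncomputable def coord : C(unitInterval, ℂ) := ⟨fun s => ((s : ℝ) : ℂ), by fun_prop⟩

@[simp] theorem coord_apply (s : unitInterval) : coord s = ((s : ℝ) : ℂ) := rfl

theorem evalLeft_surjective (hq : 0 < q) :
    Function.Surjective (evalLeft (p := p) (q := q) hq) := fun a =>
  ⟨smulConst (1 - coord) (a ⊗ₖ 1) ⟨a, by simp⟩ ⟨0, by simp⟩, by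
    simp [leftFactor_kronecker_one hq]⟩

theorem evalRight_surjective (hp : 0 < p) :
    Function.Surjective (evalRight (p := p) (q := q) hp) := fun b =>
  ⟨smulConst coord (1 ⊗ₖ b) ⟨0, by simp⟩ ⟨b, by simp⟩, by
    simp [rightFactor_one_kronecker hp]⟩

theorem evalAt_surjective {s : unitInterval} (h0 : s ≠ 0) (h1 : s ≠ 1) :
    Function.Surjective (evalAt (p := p) (q := q) s) := fun M => by
  have h0' : ((s : ℝ) : ℂ) ≠ 0 := by
    simpa using h0
  have h1' : 1 - ((s : ℝ) : ℂ) ≠ 0 := by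
    rw [sub_ne_zero]; norm_cast; exact fun h => h1 (Subtype.ext h.symm)
  refine ⟨smulConst (coord * (1 - coord)) ((((s : ℝ) : ℂ) * (1 - ((s : ℝ) : ℂ)))⁻¹ • M)
    ⟨0, by simp⟩ ⟨0, by simp⟩, ?_⟩
  rw [evalAt_apply, smulConst_apply, smul_smul]
  simp only [ContinuousMap.mul_apply, ContinuousMap.sub_apply, ContinuousMap.one_apply, coord_apply]
  rw [mul_inv_cancel₀ (mul_ne_zero h0' h1'), one_smul]

end DimensionDrop

namespace DimensionDrop

/-! ### Irreducible subrepresentations from eigenvectors of the centre. -/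

section Intertwiner

variable {p q : ℕ} {n J : Type*} [Fintype n] [DecidableEq n] [Fintype J] [DecidableEq J]

theorem hom_sub {R : Type*} [Ring R] [Algebra ℂ R] [Star R] (π : dimensionDrop p q →⋆ₐ[ℂ] R)
    (f g : dimensionDrop p q) : π (f - g) = π f - π g :=
  map_sub (π : dimensionDrop p q →+* R) f g

theorem norm_hom_le (π : dimensionDrop p q →⋆ₐ[ℂ] Matrix n n ℂ) (f : dimensionDrop p q) :
    ‖π f‖ ≤ ‖f‖ := NonUnitalStarAlgHom.norm_apply_le π f

open scoped ComplexOrder in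
/-- A vector on which `π` factors through a surjection onto a full matrix algebra generates a copy
of the standard representation of that matrix algebra. -/
theorem exists_intertwiner (π : dimensionDrop p q →⋆ₐ[ℂ] Matrix n n ℂ) (X : dimensionDrop p q →⋆ₐ[ℂ] Matrix J J ℂ)
    (hX : Function.Surjective X) {Q : Matrix n n ℂ} (hQ : ∀ f, Q * π f = π f * Q)
    {v : n → ℂ} (hv : v ≠ 0) (hQv : Q *ᵥ v = v) (hk : ∀ f, X f = 0 → π f *ᵥ v = 0) :
    ∃ V : Matrix n J ℂ, Vᴴ * V = 1 ∧ Q * V = V ∧ ∀ f, π f * V = V * X f := by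
  choose E hE using fun i j : J => hX (Matrix.single i j 1)
  have congr {w : n → ℂ} (hk : ∀ f, X f = 0 → π f *ᵥ w = 0) {f g : dimensionDrop p q} (h : X f = X g) :
      π f *ᵥ w = π g *ᵥ w := by
    rw [← sub_eq_zero, ← Matrix.sub_mulVec, ← hom_sub]
    exact hk _ (by rw [hom_sub, h, sub_self])
  -- On `v` the action of `π f` depends only on `X f`, and `∑ i, E i i` has the same image under `X`
  -- as `1`. So its terms cannot all kill `v`.
  obtain ⟨i₀, hi₀⟩ : ∃ i, π (E i i) *ᵥ v ≠ 0 := by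
    by_contra! H
    apply hv
    have : π 1 *ᵥ v = π (∑ i, E i i) *ᵥ v := by
      apply congr hk
      rw [map_one, map_sum]
      simp only [hE]
      exact Matrix.sum_single_one.symm
    rw [map_one, Matrix.one_mulVec, map_sum, Matrix.sum_mulVec] at this
    rw [this, Finset.sum_eq_zero fun i _ => H i]
  obtain ⟨w, hw1, hQw, hkw, hEw⟩ : ∃ w : n → ℂ, star w ⬝ᵥ w = 1 ∧ Q *ᵥ w = w ∧
      (∀ f, X f = 0 → π f *ᵥ w = 0) ∧ π (E i₀ i₀) *ᵥ w = w := by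
    set w₀ := π (E i₀ i₀) *ᵥ v with hw₀
    have hpos : 0 < star w₀ ⬝ᵥ w₀ := Matrix.dotProduct_star_self_pos_iff.2 hi₀
    obtain ⟨r, hr, hr'⟩ := RCLike.pos_iff_exists_ofReal.1 hpos
    have hr0 : ((√r : ℝ) : ℂ) ≠ 0 := by
      simpa using (Real.sqrt_pos.2 hr).ne'
    refine ⟨((√r : ℝ) : ℂ)⁻¹ • w₀, ?_, ?_, ?_, ?_⟩
    · rw [star_smul, smul_dotProduct, dotProduct_smul, ← hr']
      have : ((√r : ℝ) : ℂ) * ((√r : ℝ) : ℂ) = r := by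
        rw [← Complex.ofReal_mul, Real.mul_self_sqrt hr.le]
      simp only [star_inv₀, smul_eq_mul]
      rw [Complex.star_def, Complex.conj_ofReal]
      simp only [Complex.coe_algebraMap]
      rw [← this]
      field_simp
    · rw [Matrix.mulVec_smul, hw₀, Matrix.mulVec_mulVec, hQ, ← Matrix.mulVec_mulVec, hQv]
    · intro f hf
      rw [Matrix.mulVec_smul, hw₀, Matrix.mulVec_mulVec, ← map_mul,
        hk _ (by rw [map_mul, hf, zero_mul]), smul_zero]
    · rw [Matrix.mulVec_smul, hw₀, Matrix.mulVec_mulVec, ← map_mul]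
      congr 1
      exact congr hk (by rw [map_mul, hE, Matrix.single_mul_single_same, one_mul])
  have key (f g : dimensionDrop p q) : star (π f *ᵥ w) ⬝ᵥ (π g *ᵥ w) = star w ⬝ᵥ (π (star f * g) *ᵥ w) := by
    rw [Matrix.star_mulVec, ← Matrix.dotProduct_mulVec, Matrix.mulVec_mulVec, map_mul, map_star,
      Matrix.star_eq_conjTranspose]
  -- The columns are the translates of the unit vector `w` by lifted matrix units, hence an
  -- orthonormal family on which `π` acts as `X`.
  refine ⟨Matrix.of fun x j => (π (E j i₀) *ᵥ w) x, ?_, ?_, fun f => ?_⟩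
  · ext i j
    rw [Matrix.mul_apply]
    change star (π (E i i₀) *ᵥ w) ⬝ᵥ (π (E j i₀) *ᵥ w) = _
    rw [key]
    by_cases hij : i = j
    · subst hij
      rw [congr hkw (g := E i₀ i₀), hEw, hw1, Matrix.one_apply_eq]
      rw [map_mul, map_star, hE, hE, Matrix.star_eq_conjTranspose, Matrix.conjTranspose_single]
      simp
    · rw [hkw, dotProduct_zero, Matrix.one_apply_ne hij]
      rw [map_mul, map_star, hE, hE, Matrix.star_eq_conjTranspose, Matrix.conjTranspose_single,
        Matrix.single_mul_single_of_ne _ _ _ _ hij]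
  · ext x j
    change (Q *ᵥ (π (E j i₀) *ᵥ w)) x = _
    rw [Matrix.mulVec_mulVec, hQ, ← Matrix.mulVec_mulVec, hQw]
    rfl
  · ext x j
    change (π f *ᵥ (π (E j i₀) *ᵥ w)) x = ∑ i, (π (E i i₀) *ᵥ w) x * X f i j
    rw [Matrix.mulVec_mulVec, ← map_mul, congr hkw (g := ∑ i, X f i j • E i i₀)]
    · rw [map_sum, Matrix.sum_mulVec, Finset.sum_apply]
      refine Finset.sum_congr rfl fun i _ => ?_
      rw [map_smul, Matrix.smul_mulVec, Pi.smul_apply, smul_eq_mul, mul_comm]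
    · rw [map_mul, map_sum]
      simp only [map_smul, hE]
      ext a b
      by_cases hb : b = i₀
      · subst hb
        simp [Matrix.sum_apply, Matrix.single_apply, Matrix.mul_apply]
      · simp [Matrix.sum_apply, Matrix.mul_apply, Ne.symm hb]

end Intertwiner

section Eigenvector

variable {p q : ℕ} {n : Type*} [Fintype n] [DecidableEq n]

theorem scalar_mul (g h : C(unitInterval, ℂ)) :
    scalar (p := p) (q := q) (g * h) = scalar g * scalar h :=
  ext' fun s => by simp [smul_smul, mul_comm]

theorem scalar_one : scalar (p := p) (q := q) 1 = 1 := ext' fun s => by simp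

/-- An element vanishing at `y` is approximated by its multiples with functions vanishing at `y`. -/
theorem exists_norm_sub_mul_scalar_lt (y : unitInterval) (f : dimensionDrop p q) (hf : f.1 y = 0)
    {δ : ℝ} (hδ : 0 < δ) : ∃ h : C(unitInterval, ℂ),
      ‖f - f * (scalar h * scalar (coord - ContinuousMap.const _ ((y : ℝ) : ℂ)))‖ ≤ δ := by
  obtain ⟨r, hr, hfr⟩ := Metric.continuousAt_iff.1 (f.1.continuous.continuousAt (x := y)) δ hδ
  -- With `h(s) = (s - y) / ((s - y)² + η)` the error factor is `1 - h(s)(s - y) = η / ((s - y)² +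
  -- η)`. It is at most `1` near `y`, where `f` is small; this `η` makes it small enough at distance
  -- at least `r`.
  set η : ℝ := δ * r ^ 2 / (‖f‖ + 1) with hη
  have hη0 : 0 < η := by positivity
  have hpos (s : unitInterval) : 0 < ((s : ℝ) - y) ^ 2 + η := by positivity
  refine ⟨⟨fun s => ((((s : ℝ) - y) / (((s : ℝ) - y) ^ 2 + η) : ℝ) : ℂ), ?_⟩, ?_⟩
  · refine Complex.continuous_ofReal.comp (Continuous.div (by fun_prop) (by fun_prop) fun s => (hpos s).ne')
  refine norm_le hδ.le fun s => ?_
  have h1 : (f - f * (scalar ⟨fun s => ((((s : ℝ) - y) / (((s : ℝ) - y) ^ 2 + η) : ℝ) : ℂ), by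
        refine Complex.continuous_ofReal.comp (Continuous.div (by fun_prop) (by fun_prop) fun s => (hpos s).ne')⟩ *
      scalar (coord - ContinuousMap.const _ ((y : ℝ) : ℂ)))).1 s =
      ((η / (((s : ℝ) - y) ^ 2 + η) : ℝ) : ℂ) • f.1 s := by
    have h2 : ((η / (((s : ℝ) - y) ^ 2 + η) : ℝ) : ℂ) =
      1 - ((((s : ℝ) - y) / (((s : ℝ) - y) ^ 2 + η) : ℝ) : ℂ) * (((s : ℝ) : ℂ) - ((y : ℝ) : ℂ)) := by
      rw [← Complex.ofReal_sub, ← Complex.ofReal_mul, ← Complex.ofReal_one, ← Complex.ofReal_sub]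
      congr 1
      have := (hpos s).ne'
      field_simp
      ring
    rw [h2, sub_smul, one_smul]
    simp only [coe_sub, coe_mul, scalar_apply, ContinuousMap.sub_apply, coord_apply,
      ContinuousMap.const_apply, ContinuousMap.coe_mk, smul_mul_smul_comm, mul_one,
      Matrix.mul_smul]
  rw [h1, norm_smul, Complex.norm_real, Real.norm_of_nonneg (div_nonneg hη0.le (hpos s).le)]
  rw [div_mul_eq_mul_div, div_le_iff₀ (hpos s)]
  by_cases hs : dist s y < r
  · have := (hfr hs).le
    rw [hf, dist_zero_right] at this
    have h3 : η * ‖f.1 s‖ ≤ η * δ := by gcongr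
    nlinarith [sq_nonneg ((s : ℝ) - y)]
  · have h4 : r ^ 2 ≤ ((s : ℝ) - y) ^ 2 := by
      rw [Subtype.dist_eq, Real.dist_eq, not_lt] at hs
      rw [← sq_abs ((s : ℝ) - y)]
      gcongr
    have h5 : η * ‖f.1 s‖ ≤ η * (‖f‖ + 1) := by
      gcongr
      have := norm_apply_le f s
      linarith
    have h6 : η * (‖f‖ + 1) = δ * r ^ 2 := by
      rw [hη]; field_simp
    nlinarith

/-- A finite dimensional representation has, inside the range of any nonzero commuting projection,
a vector on which it factors through the evaluation at a point. -/
theorem exists_vector (π : dimensionDrop p q →⋆ₐ[ℂ] Matrix n n ℂ) {Q : Matrix n n ℂ}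
    (hQ0 : Q ≠ 0) (hQQ : Q * Q = Q) (hQ : ∀ f, Q * π f = π f * Q) :
    ∃ (y : unitInterval) (v : n → ℂ), v ≠ 0 ∧ Q *ᵥ v = v ∧ ∀ f, f.1 y = 0 → π f *ᵥ v = 0 := by
  -- Working inside the range of `Q` keeps the new vector orthogonal to the blocks already split
  -- off. There the central element `scalar coord` has an eigenvector.
  set W : Submodule ℂ (n → ℂ) := LinearMap.range Q.mulVecLin with hW
  have hWn : Nontrivial W := by
    rw [Submodule.nontrivial_iff_ne_bot, Ne, LinearMap.range_eq_bot]
    intro h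
    apply hQ0
    ext i j
    have := congrFun (LinearMap.congr_fun h (Pi.single j 1)) i
    simpa using this
  have hinv : ∀ x ∈ W, (π (scalar coord)).mulVecLin x ∈ W := by
    rintro _ ⟨u, rfl⟩
    exact ⟨π (scalar coord) *ᵥ u, by simp [hQ]⟩
  obtain ⟨lam, hlam⟩ := Module.End.exists_eigenvalue ((π (scalar coord)).mulVecLin.restrict hinv)
  obtain ⟨⟨v, hvW⟩, hv⟩ := hlam.exists_hasEigenvector
  have hv0 : v ≠ 0 := fun h => hv.2 (Subtype.ext h)
  have hev : π (scalar coord) *ᵥ v = lam • v := congrArg Subtype.val hv.apply_eq_smul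
  have hQv : Q *ᵥ v = v := by
    obtain ⟨u, rfl⟩ := hvW
    simp [hQQ]
  have hscal (h : C(unitInterval, ℂ)) :
      π (scalar h * scalar (coord - ContinuousMap.const _ lam)) *ᵥ v = 0 := by
    rw [map_mul, ← Matrix.mulVec_mulVec]
    have : scalar (p := p) (q := q) (coord - ContinuousMap.const _ lam) = scalar coord - lam • 1 :=
      ext' fun s => by simp [sub_smul]
    rw [this, hom_sub, map_smul, map_one, Matrix.sub_mulVec, Matrix.smul_mulVec,
      Matrix.one_mulVec, hev, sub_self, Matrix.mulVec_zero]
  -- For an eigenvalue outside `[0,1]`, `coord - lam` would be invertible and yet kill `v`.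
  obtain ⟨y, rfl⟩ : ∃ y : unitInterval, ((y : ℝ) : ℂ) = lam := by
    by_contra! H
    apply hv0
    have hne (s : unitInterval) : ((s : ℝ) : ℂ) - lam ≠ 0 := sub_ne_zero.2 (H s)
    have h1 := hscal ⟨fun s => (((s : ℝ) : ℂ) - lam)⁻¹, Continuous.inv₀ (by fun_prop) hne⟩
    rw [← scalar_mul] at h1
    have h2 : (⟨fun s => (((s : ℝ) : ℂ) - lam)⁻¹, Continuous.inv₀ (by fun_prop) hne⟩ :
        C(unitInterval, ℂ)) * (coord - ContinuousMap.const _ lam) = 1 :=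
      ContinuousMap.ext fun s => inv_mul_cancel₀ (hne s)
    rwa [h2, scalar_one, map_one, Matrix.one_mulVec] at h1
  refine ⟨y, v, hv0, hQv, fun f hf => ?_⟩
  have hle (δ : ℝ) (hδ : 0 < δ) : ‖WithLp.toLp 2 (π f *ᵥ v)‖ ≤ δ * ‖WithLp.toLp 2 v‖ := by
    obtain ⟨h, hh⟩ := exists_norm_sub_mul_scalar_lt y f hf hδ
    have h1 : π f *ᵥ v =
        π (f - f * (scalar h * scalar (coord - ContinuousMap.const _ ((y : ℝ) : ℂ)))) *ᵥ v := by
      rw [hom_sub, Matrix.sub_mulVec, map_mul _ f, ← Matrix.mulVec_mulVec _ (π f), hscal,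
        Matrix.mulVec_zero, sub_zero]
    have h2 := (norm_hom_le π
      (f - f * (scalar h * scalar (coord - ContinuousMap.const _ ((y : ℝ) : ℂ))))).trans hh
    rw [h1]
    refine (Matrix.l2_opNorm_mulVec _ (WithLp.toLp 2 v)).trans ?_
    gcongr
  have h0 : ‖WithLp.toLp 2 (π f *ᵥ v)‖ ≤ 0 := by
    refine le_of_forall_pos_le_add fun ε hε => ?_
    rw [zero_add]
    refine (hle (ε / (‖WithLp.toLp 2 v‖ + 1)) (by positivity)).trans ?_
    rw [div_mul_eq_mul_div, div_le_iff₀ (by positivity)]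
    nlinarith [norm_nonneg (WithLp.toLp 2 v)]
  have := norm_le_zero_iff.1 h0
  simpa using this

end Eigenvector

end DimensionDrop

/-! ### Decomposition of finite-dimensional representations. -/

namespace DimensionDrop

open scoped ComplexOrder in
theorem trace_re_nonneg {n : Type*} [Fintype n] {Q : Matrix n n ℂ} (hQs : Qᴴ = Q) (hQQ : Q * Q = Q) : 0 ≤ Q.trace.re := by
  have := Matrix.PosSemidef.trace_nonneg (Matrix.posSemidef_conjTranspose_mul_self Q)
  rw [hQs, hQQ] at this
  exact (Complex.le_def.1 this).1

section Blocks

variable {p q : ℕ} {n : Type*} [Fintype n] [DecidableEq n]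

/-- `Q` is the sum of the ranges of intertwiners between `π` and the standard representations of the
dimension drop algebra: at the left end point (indexed by `I₀`), at the points `t i`, and at the
right end point (indexed by `I₁`). -/
def HasBlocks (hp : 0 < p) (hq : 0 < q) (π : dimensionDrop p q →⋆ₐ[ℂ] Matrix n n ℂ)
    (Q : Matrix n n ℂ) (I₀ K I₁ : Type) [Fintype I₀] [Fintype K] [Fintype I₁]
    (t : K → unitInterval) : Prop :=
  ∃ (V₀ : I₀ → Matrix n (Fin p) ℂ) (V : K → Matrix n (Fin p × Fin q) ℂ)
    (V₁ : I₁ → Matrix n (Fin q) ℂ),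
    (∀ i f, π f * V₀ i = V₀ i * evalLeft hq f) ∧
    (∀ i f, π f * V i = V i * evalAt (t i) f) ∧
    (∀ i f, π f * V₁ i = V₁ i * evalRight hp f) ∧
    Q = ∑ i, V₀ i * (V₀ i)ᴴ + (∑ i, V i * (V i)ᴴ + ∑ i, V₁ i * (V₁ i)ᴴ) ∧
    Q.trace = p * Fintype.card I₀ + (p * q * Fintype.card K + q * Fintype.card I₁)

variable {hp : 0 < p} {hq : 0 < q} {π : dimensionDrop p q →⋆ₐ[ℂ] Matrix n n ℂ} {Q : Matrix n n ℂ}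

theorem exists_block (hp : 0 < p) (hq : 0 < q)
    (hQ0 : Q ≠ 0) (hQQ : Q * Q = Q) (hQ : ∀ f, Q * π f = π f * Q) :
    (∃ V : Matrix n (Fin p) ℂ, Vᴴ * V = 1 ∧ Q * V = V ∧ ∀ f, π f * V = V * evalLeft hq f) ∨
    (∃ (s : unitInterval) (V : Matrix n (Fin p × Fin q) ℂ), Vᴴ * V = 1 ∧ Q * V = V ∧
      ∀ f, π f * V = V * evalAt s f) ∨
    (∃ V : Matrix n (Fin q) ℂ, Vᴴ * V = 1 ∧ Q * V = V ∧ ∀ f, π f * V = V * evalRight hp f) := by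
  obtain ⟨y, v, hv, hQv, hk⟩ := exists_vector π hQ0 hQQ hQ
  by_cases h0 : y = 0
  · subst h0
    exact .inl (exists_intertwiner π _ (evalLeft_surjective hq) hQ hv hQv
      fun f hf => hk f ((evalLeft_eq_zero hq f).1 hf))
  by_cases h1 : y = 1
  · subst h1
    exact .inr (.inr (exists_intertwiner π _ (evalRight_surjective hp) hQ hv hQv
      fun f hf => hk f ((evalRight_eq_zero hp f).1 hf)))
  exact .inr (.inl ⟨y, exists_intertwiner π _ (evalAt_surjective h0 h1) hQ hv hQv hk⟩)

/-- `V * Vᴴ` is a subprojection of `Q` that commutes with `π`, by the intertwining relation and its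
adjoint. This is the inductive step: what remains after splitting off a block satisfies the same
assumptions as `Q`, with smaller trace. -/
theorem sub_mul_conjTranspose {J : Type*} [Fintype J] [DecidableEq J]
    (hQs : Qᴴ = Q) (hQQ : Q * Q = Q) (hQ : ∀ f, Q * π f = π f * Q)
    {V : Matrix n J ℂ} (hVV : Vᴴ * V = 1) (hQV : Q * V = V)
    {X : dimensionDrop p q →⋆ₐ[ℂ] Matrix J J ℂ} (hV : ∀ f, π f * V = V * X f) :
    (Q - V * Vᴴ)ᴴ = Q - V * Vᴴ ∧ (Q - V * Vᴴ) * (Q - V * Vᴴ) = Q - V * Vᴴ ∧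
    (∀ f, (Q - V * Vᴴ) * π f = π f * (Q - V * Vᴴ)) ∧
    (Q - V * Vᴴ).trace = Q.trace - Fintype.card J := by
  have hVQ : Vᴴ * Q = Vᴴ := by
    rw [← hQs, ← Matrix.conjTranspose_mul, hQV]
  have hV' (f) : Vᴴ * π f = X f * Vᴴ := by
    have := congrArg Matrix.conjTranspose (hV (star f))
    rw [Matrix.conjTranspose_mul, Matrix.conjTranspose_mul, map_star, map_star,
      Matrix.star_eq_conjTranspose, Matrix.star_eq_conjTranspose,
      Matrix.conjTranspose_conjTranspose, Matrix.conjTranspose_conjTranspose] at this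
    exact this
  refine ⟨?_, ?_, fun f => ?_, ?_⟩
  · rw [Matrix.conjTranspose_sub, Matrix.conjTranspose_mul, Matrix.conjTranspose_conjTranspose, hQs]
  · rw [mul_sub, sub_mul, sub_mul, hQQ, Matrix.mul_assoc V Vᴴ Q, hVQ, ← Matrix.mul_assoc Q V, hQV,
      Matrix.mul_assoc V Vᴴ, ← Matrix.mul_assoc Vᴴ V, hVV, Matrix.one_mul]
    abel
  · rw [sub_mul, mul_sub, hQ, Matrix.mul_assoc V, hV', ← Matrix.mul_assoc (π f), hV,
      Matrix.mul_assoc]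
  · rw [Matrix.trace_sub, Matrix.trace_mul_comm, hVV, Matrix.trace_one]

/-- Each block split off lowers the trace by its size, which is at least one, and projections have
nonnegative trace; so `N`, a strict bound for the trace, serves as induction variable. -/
theorem exists_hasBlocks_aux (hp : 0 < p) (hq : 0 < q) (N : ℕ) : ∀ Q : Matrix n n ℂ,
    Qᴴ = Q → Q * Q = Q → (∀ f, Q * π f = π f * Q) → Q.trace.re < N →
    ∃ (a k b : ℕ) (t : Fin k → unitInterval), HasBlocks hp hq π Q (Fin a) (Fin k) (Fin b) t := by
  induction N with
  | zero =>
    intro Q hQs hQQ _ h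
    have := trace_re_nonneg hQs hQQ
    norm_num at h
    linarith
  | succ N ih =>
    intro Q hQs hQQ hQ h
    by_cases hQ0 : Q = 0
    · refine ⟨0, 0, 0, Fin.elim0, Fin.elim0, Fin.elim0, Fin.elim0, fun i => i.elim0,
        fun i => i.elim0, fun i => i.elim0, ?_, ?_⟩ <;> simp [hQ0]
    have bound {J : Type} [Fintype J] (hJ : 0 < Fintype.card J) {Q' : Matrix n n ℂ}
        (h' : Q'.trace = Q.trace - Fintype.card J) : Q'.trace.re < N := by
      rw [h', Complex.sub_re, Complex.natCast_re]
      have : (1 : ℝ) ≤ Fintype.card J := by exact_mod_cast hJ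
      push_cast at h
      linarith
    rcases exists_block hp hq hQ0 hQQ hQ with ⟨V, hVV, hQV, hV⟩ | ⟨s, V, hVV, hQV, hV⟩ |
      ⟨V, hVV, hQV, hV⟩
    · obtain ⟨h1, h2, h3, h4⟩ := sub_mul_conjTranspose hQs hQQ hQ hVV hQV hV
      obtain ⟨a, k, b, t, V₀, V', V₁, i0, i, i1, hs, ht⟩ := ih _ h1 h2 h3 (bound (by simpa) h4)
      refine ⟨a + 1, k, b, t, Fin.cons V V₀, V', V₁, ?_, i, i1, ?_, ?_⟩
      · intro j
        refine Fin.cases ?_ (fun j => ?_) j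
        · simpa using hV
        · simpa using i0 j
      · rw [Fin.sum_univ_succ]
        simp only [Fin.cons_zero, Fin.cons_succ]
        rw [add_assoc, ← hs, add_sub_cancel]
      · rw [h4] at ht
        simp only [Fintype.card_fin] at ht ⊢
        push_cast
        linear_combination ht
    · obtain ⟨h1, h2, h3, h4⟩ := sub_mul_conjTranspose hQs hQQ hQ hVV hQV hV
      obtain ⟨a, k, b, t, V₀, V', V₁, i0, i, i1, hs, ht⟩ :=
        ih _ h1 h2 h3 (bound (by simpa using ⟨hp, hq⟩) h4)
      refine ⟨a, k + 1, b, Fin.cons s t, V₀, Fin.cons V V', V₁, i0, ?_, i1, ?_, ?_⟩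
      · intro j
        refine Fin.cases ?_ (fun j => ?_) j
        · simpa using hV
        · simpa using i j
      · rw [Fin.sum_univ_succ]
        simp only [Fin.cons_zero, Fin.cons_succ]
        rw [add_assoc, add_left_comm, ← hs, add_sub_cancel]
      · rw [h4] at ht
        simp only [Fintype.card_fin, Fintype.card_prod] at ht ⊢
        push_cast at ht ⊢
        linear_combination ht
    · obtain ⟨h1, h2, h3, h4⟩ := sub_mul_conjTranspose hQs hQQ hQ hVV hQV hV
      obtain ⟨a, k, b, t, V₀, V', V₁, i0, i, i1, hs, ht⟩ := ih _ h1 h2 h3 (bound (by simpa) h4)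
      refine ⟨a, k, b + 1, t, V₀, V', Fin.cons V V₁, i0, i, ?_, ?_, ?_⟩
      · intro j
        refine Fin.cases ?_ (fun j => ?_) j
        · simpa using hV
        · simpa using i1 j
      · rw [Fin.sum_univ_succ]
        simp only [Fin.cons_zero, Fin.cons_succ]
        rw [add_left_comm (∑ i, V' i * (V' i)ᴴ), add_left_comm, ← hs, add_sub_cancel]
      · rw [h4] at ht
        simp only [Fintype.card_fin] at ht ⊢
        push_cast
        linear_combination ht

variable {I₀ K I₁ : Type} [Fintype I₀] [Fintype K] [Fintype I₁] {t : K → unitInterval}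

theorem HasBlocks.reindex (h : HasBlocks hp hq π Q I₀ K I₁ t) {K' : Type} [Fintype K']
    (e : K' ≃ K) : HasBlocks hp hq π Q I₀ K' I₁ (t ∘ e) := by
  obtain ⟨V₀, V, V₁, i0, i, i1, hs, ht⟩ := h
  refine ⟨V₀, V ∘ e, V₁, i0, fun j => i (e j), i1, ?_, by rw [ht, Fintype.card_congr e]⟩
  rw [hs, ← e.sum_comp]
  rfl

/-- `q` copies of the representation at the left end point form the evaluation at `0`. -/
theorem HasBlocks.merge_left (h : HasBlocks hp hq π Q I₀ K I₁ t) {I₀' L : Type} [Fintype I₀']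
    [Fintype L] (e : I₀' ⊕ (L × Fin q) ≃ I₀) :
    HasBlocks hp hq π Q I₀' (L ⊕ K) I₁ (Sum.elim (fun _ => 0) t) := by
  obtain ⟨V₀, V, V₁, i0, i, i1, hs, ht⟩ := h
  -- Since `f(0) = c(f(0)) ⊗ 1_q`, the column `(i, j)` of a merged block is column `i` of the `j`-th
  -- copy.
  refine ⟨fun j => V₀ (e (.inl j)), Sum.elim
    (fun l => Matrix.of fun x ij => V₀ (e (.inr (l, ij.2))) x ij.1) V, V₁, fun j => i0 _, ?_, i1,
      ?_, ?_⟩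
  · rintro (l | j)
    · intro f
      ext x ⟨a, b⟩
      have := congrFun (congrFun (i0 (e (.inr (l, b))) f) x) a
      simp only [Sum.elim_inl, evalAt_apply]
      rw [apply_zero_eq hq f]
      simp only [Matrix.mul_apply, Matrix.of_apply, evalLeft_apply] at this ⊢
      rw [this, Fintype.sum_prod_type]
      refine Finset.sum_congr rfl fun c _ => ?_
      rw [Finset.sum_eq_single b (fun d _ hd => by simp [hd]) (by simp)]
      simp
    · exact i j
  · rw [hs, ← e.sum_comp, Fintype.sum_sum_type, Fintype.sum_sum_type]
    simp only [Sum.elim_inl, Sum.elim_inr]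
    rw [add_assoc, add_assoc (∑ l, _) (∑ j, V j * _)]
    congr 2
    rw [Fintype.sum_prod_type]
    refine Finset.sum_congr rfl fun l _ => ?_
    ext x y
    simp only [Matrix.sum_apply, Matrix.mul_apply, Matrix.conjTranspose_apply, Matrix.of_apply]
    rw [Fintype.sum_prod_type, Finset.sum_comm]
  · rw [ht, ← Fintype.card_congr e]
    simp only [Fintype.card_sum, Fintype.card_prod, Fintype.card_fin]
    push_cast
    ring

/-- `p` copies of the representation at the right end point form the evaluation at `1`. -/
theorem HasBlocks.merge_right (h : HasBlocks hp hq π Q I₀ K I₁ t) {I₁' L : Type} [Fintype I₁']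
    [Fintype L] (e : I₁' ⊕ (L × Fin p) ≃ I₁) :
    HasBlocks hp hq π Q I₀ (L ⊕ K) I₁' (Sum.elim (fun _ => 1) t) := by
  obtain ⟨V₀, V, V₁, i0, i, i1, hs, ht⟩ := h
  refine ⟨V₀, Sum.elim (fun l => Matrix.of fun x ij => V₁ (e (.inr (l, ij.1))) x ij.2) V,
    fun j => V₁ (e (.inl j)), i0, ?_, fun j => i1 _, ?_, ?_⟩
  · rintro (l | j)
    · intro f
      ext x ⟨a, b⟩
      have := congrFun (congrFun (i1 (e (.inr (l, a))) f) x) b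
      simp only [Sum.elim_inl, evalAt_apply]
      rw [apply_one_eq hp f]
      simp only [Matrix.mul_apply, Matrix.of_apply, evalRight_apply] at this ⊢
      rw [this, Fintype.sum_prod_type, Finset.sum_comm]
      refine Finset.sum_congr rfl fun c _ => ?_
      rw [Finset.sum_eq_single a (fun d _ hd => by simp [hd]) (by simp)]
      simp
    · exact i j
  · rw [hs, ← e.sum_comp, Fintype.sum_sum_type, Fintype.sum_sum_type]
    simp only [Sum.elim_inl, Sum.elim_inr]
    have key : ∑ x : L × Fin p, V₁ (e (.inr x)) * (V₁ (e (.inr x)))ᴴ =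
        ∑ l : L, (Matrix.of fun x (ij : Fin p × Fin q) => V₁ (e (.inr (l, ij.1))) x ij.2) *
          (Matrix.of fun x (ij : Fin p × Fin q) => V₁ (e (.inr (l, ij.1))) x ij.2)ᴴ := by
      rw [Fintype.sum_prod_type]
      refine Finset.sum_congr rfl fun l _ => ?_
      ext x y
      simp only [Matrix.sum_apply, Matrix.mul_apply, Matrix.conjTranspose_apply, Matrix.of_apply]
      rw [Fintype.sum_prod_type]
    rw [key]
    abel
  · rw [ht, ← Fintype.card_congr e]
    simp only [Fintype.card_sum, Fintype.card_prod, Fintype.card_fin]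
    push_cast
    ring

theorem exists_fin_equiv_mod (a : ℕ) (q : ℕ) :
    Nonempty (Fin (a % q) ⊕ (Fin (a / q) × Fin q) ≃ Fin a) :=
  ⟨Fintype.equivOfCardEq (by simp [Nat.mod_add_div'])⟩

/-- Every finite dimensional representation of a dimension drop algebra is a direct sum of
standard ones, with normalized multiplicities. -/
theorem exists_hasBlocks (hp : 0 < p) (hq : 0 < q) (π : dimensionDrop p q →⋆ₐ[ℂ] Matrix n n ℂ) :
    ∃ (a b k : ℕ) (t : Fin k → unitInterval), a < q ∧ b < p ∧ Monotone t ∧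
      HasBlocks hp hq π 1 (Fin a) (Fin k) (Fin b) t := by
  obtain ⟨a, k, b, t, h⟩ := exists_hasBlocks_aux (π := π) hp hq (Fintype.card n + 1) 1
    Matrix.conjTranspose_one (one_mul 1) (fun f => by rw [one_mul, mul_one])
    (by rw [Matrix.trace_one]; simp)
  obtain ⟨e0⟩ := exists_fin_equiv_mod a q
  obtain ⟨e1⟩ := exists_fin_equiv_mod b p
  have h' := (h.merge_left e0).merge_right e1
  set T := Sum.elim (fun _ => 1) (Sum.elim (fun _ => 0) t) with hT
  have e := (Fintype.equivFin (Fin (b / p) ⊕ (Fin (a / q) ⊕ Fin k))).symm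
  have h'' := (h'.reindex e).reindex (Tuple.sort (T ∘ e))
  exact ⟨a % q, b % p, _, _, Nat.mod_lt _ hq, Nat.mod_lt _ hp, Tuple.monotone_sort (T ∘ e), h''⟩

theorem HasBlocks.card_eq {a b k : ℕ} {t : Fin k → unitInterval}
    (h : HasBlocks hp hq π 1 (Fin a) (Fin k) (Fin b) t) :
    p * a + (p * q * k + q * b) = Fintype.card n := by
  obtain ⟨V₀, V, V₁, i0, i, i1, hs, ht⟩ := h
  rw [Matrix.trace_one] at ht
  simp only [Fintype.card_fin] at ht
  exact_mod_cast ht.symm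

/-- The blocks placed side by side form the unitary. The eigenvalues over a single point are encoded
as constant functions, so the parameter `0` is a dummy. -/
theorem HasBlocks.exists_unitary {a b k : ℕ} {t : Fin k → unitInterval}
    (h : HasBlocks hp hq π 1 (Fin a) (Fin k) (Fin b) t)
    (e : (Fin p × Fin a) ⊕ (((Fin p × Fin q) × Fin k) ⊕ (Fin q × Fin b)) ≃ n) :
    ∃ v : Matrix.unitaryGroup n ℂ, ∀ f, π f = (v : Matrix n n ℂ) *
      Matrix.reindex e e (patternMatrix a b (fun i => ContinuousMap.const _ (t i)) f 0) *
        (v : Matrix n n ℂ)ᴴ := by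
  obtain ⟨V₀, V, V₁, i0, i, i1, hs, ht⟩ := h
  set U : Matrix n ((Fin p × Fin a) ⊕ (((Fin p × Fin q) × Fin k) ⊕ (Fin q × Fin b))) ℂ :=
    Matrix.of fun x => Sum.elim (fun j => V₀ j.2 x j.1)
      (Sum.elim (fun j => V j.2 x j.1) (fun j => V₁ j.2 x j.1)) with hU
  have hUU : U * Uᴴ = 1 := by
    rw [hs]
    ext x y
    simp only [hU, Matrix.mul_apply, Matrix.conjTranspose_apply, Matrix.of_apply,
      Fintype.sum_sum_type, Sum.elim_inl, Sum.elim_inr, Matrix.add_apply, Matrix.sum_apply]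
    congr 1
    · rw [Fintype.sum_prod_type_right]
    · congr 1
      · rw [Fintype.sum_prod_type_right]
      · rw [Fintype.sum_prod_type_right]
  have hint (f) : π f * U = U * patternMatrix a b (fun i => ContinuousMap.const _ (t i)) f 0 := by
    ext x (⟨j, c⟩ | ⟨j, c⟩ | ⟨j, c⟩)
    · have := congrFun (congrFun (i0 c f) x) j
      rw [Matrix.mul_apply, Matrix.mul_apply] at this
      simp only [hU, patternMatrix, Matrix.mul_apply, Matrix.of_apply, Sum.elim_inl, Sum.elim_inr,
        Fintype.sum_sum_type, Matrix.fromBlocks_apply₁₁, Matrix.fromBlocks_apply₂₁,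
        Matrix.zero_apply, mul_zero, Finset.sum_const_zero, add_zero]
      rw [this, Fintype.sum_prod_type]
      refine Finset.sum_congr rfl fun d _ => ?_
      rw [Finset.sum_eq_single c (fun g _ hg => by simp [Matrix.blockDiagonal_apply, hg]) (by simp)]
      simp [Matrix.blockDiagonal_apply]
    · have := congrFun (congrFun (i c f) x) j
      rw [Matrix.mul_apply, Matrix.mul_apply] at this
      simp only [hU, patternMatrix, Matrix.mul_apply, Matrix.of_apply, Sum.elim_inl, Sum.elim_inr,
        Fintype.sum_sum_type, Matrix.fromBlocks_apply₁₁, Matrix.fromBlocks_apply₂₁,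
        Matrix.fromBlocks_apply₁₂, Matrix.fromBlocks_apply₂₂,
        Matrix.zero_apply, mul_zero, Finset.sum_const_zero, add_zero, zero_add]
      rw [this]
      symm
      rw [Fintype.sum_prod_type]
      refine Finset.sum_congr rfl fun d _ => ?_
      rw [Finset.sum_eq_single c (fun g _ hg => by simp [Matrix.blockDiagonal_apply, hg]) (by simp)]
      simp [Matrix.blockDiagonal_apply]
    · have := congrFun (congrFun (i1 c f) x) j
      rw [Matrix.mul_apply, Matrix.mul_apply] at this
      simp only [hU, patternMatrix, Matrix.mul_apply, Matrix.of_apply, Sum.elim_inl, Sum.elim_inr,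
        Fintype.sum_sum_type, Matrix.fromBlocks_apply₁₂, Matrix.fromBlocks_apply₂₂,
        Matrix.zero_apply, mul_zero, Finset.sum_const_zero, zero_add]
      rw [this, Fintype.sum_prod_type]
      refine Finset.sum_congr rfl fun d _ => ?_
      rw [Finset.sum_eq_single c (fun g _ hg => by simp [Matrix.blockDiagonal_apply, hg]) (by simp)]
      simp [Matrix.blockDiagonal_apply]
  -- The bijection `e` makes the matrix square, so this one-sided identity suffices for unitarity.
  have hvv : U.submatrix id e.symm * (U.submatrix id e.symm)ᴴ = 1 := by
    rw [Matrix.conjTranspose_submatrix, Matrix.submatrix_mul_equiv, hUU, Matrix.submatrix_id_id]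
  refine ⟨⟨U.submatrix id e.symm, Matrix.mem_unitaryGroup_iff.2 hvv⟩, fun f => ?_⟩
  rw [Matrix.reindex_apply, Matrix.submatrix_mul_equiv, ← hint, Matrix.conjTranspose_submatrix,
    Matrix.submatrix_mul_equiv, Matrix.mul_assoc, hUU, Matrix.mul_one, Matrix.submatrix_id_id]

end Blocks

end DimensionDrop

/-! ### Existence and continuity of eigenvalue patterns. -/

namespace DimensionDrop

variable {p q p' q' k : ℕ}

theorem trace_patternMatrix (a b : ℕ) (t : Fin k → C(unitInterval, unitInterval))
    (f : dimensionDrop p q) (s : unitInterval) :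
    (patternMatrix a b t f s).trace = a * (leftFactor (f.1 0)).trace +
      (∑ i, (f.1 (t i s)).trace + b * (rightFactor (f.1 1)).trace) := by
  simp [patternMatrix, Matrix.trace, Fintype.sum_prod_type_right, Matrix.blockDiagonal_apply]

theorem trace_conj {n J : Type*} [Fintype n] [DecidableEq n] [Fintype J] [DecidableEq J]
    (v : Matrix.unitaryGroup n ℂ) (e : J ≃ n) (M : Matrix J J ℂ) :
    ((v : Matrix n n ℂ) * Matrix.reindex e e M * (v : Matrix n n ℂ)ᴴ).trace = M.trace := by
  have hv : (v : Matrix n n ℂ)ᴴ * v = 1 := Matrix.mem_unitaryGroup_iff'.1 v.2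
  rw [Matrix.trace_mul_comm, ← Matrix.mul_assoc, hv, Matrix.one_mul, Matrix.reindex_apply,
    Matrix.trace, Matrix.trace, ← e.sum_comp]
  simp

theorem trace_patternMatrix_scalar (hp : 0 < p) (hq : 0 < q) (a b : ℕ)
    (t : Fin k → C(unitInterval, unitInterval)) (h : C(unitInterval, ℂ)) (s : unitInterval) :
    (patternMatrix (p := p) (q := q) a b t (scalar h) s).trace = p * a * h 0 +
      (p * q * ∑ i, h (t i s) + q * b * h 1) := by
  rw [trace_patternMatrix]
  simp only [scalar_apply, leftFactor_smul, rightFactor_smul, leftFactor_one hq,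
    rightFactor_one hp, Matrix.trace_smul, Matrix.trace_one, Fintype.card_fin, Fintype.card_prod,
    smul_eq_mul, ← Finset.sum_mul]
  push_cast
  ring

/-- A sorted tuple depending on a parameter is continuous if all its symmetric sums are. -/
theorem continuous_of_continuous_sum {S : Type*} [TopologicalSpace S]
    {t : S → Fin k → unitInterval} (ht : ∀ s, Monotone (t s))
    (h : ∀ g : C(unitInterval, ℝ), Continuous fun s => ∑ i, g (t s i)) (i : Fin k) :
    Continuous fun s => t s i := by
  rw [OrderTopology.continuous_iff]
  intro c
  constructor
  · rw [isOpen_iff_mem_nhds]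
    intro s₀ (hs₀ : c < t s₀ i)
    -- The sum of `g` roughly counts eigenvalues above `c`. It is at least `#(Ici i)` at `s₀`, but
    -- at most `#(Ioi i)`, one less, wherever `t s i ≤ c`; continuity excludes such `s` near `s₀`.
    obtain ⟨g, hg0, hg1, hg⟩ := exists_continuous_zero_one_of_isClosed (X := unitInterval)
      (isClosed_Iic (a := c)) (isClosed_Ici (a := t s₀ i))
      (Set.disjoint_left.2 fun x hx hx' => absurd (lt_of_lt_of_le hs₀ (le_trans hx' hx)) (lt_irrefl _))
    have h1 : ((Finset.Ici i).card : ℝ) ≤ ∑ j, g (t s₀ j) := by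
      have : ∑ j ∈ Finset.Ici i, g (t s₀ j) = (Finset.Ici i).card := by
        rw [Finset.sum_congr rfl fun j hj => hg1 (ht s₀ (Finset.mem_Ici.1 hj))]
        simp
      rw [← this]
      exact Finset.sum_le_sum_of_subset_of_nonneg (Finset.subset_univ _) fun j _ _ => (hg _).1
    have h2 := (h g).continuousAt.eventually (lt_mem_nhds
      (show ((Finset.Ici i).card : ℝ) - 1 < ∑ j, g (t s₀ j) by linarith))
    filter_upwards [h2] with s hs
    by_contra! hc
    have hc' : t s i ≤ c := not_lt.1 hc
    have h3 : ∑ j, g (t s j) ≤ ((Finset.Ioi i).card : ℝ) := by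
      have : ∑ j, g (t s j) = ∑ j ∈ Finset.Ioi i, g (t s j) := by
        symm
        refine Finset.sum_subset (Finset.subset_univ _) fun j _ hj => hg0 ?_
        rw [Finset.mem_Ioi, not_lt] at hj
        exact (ht s hj).trans hc'
      rw [this]
      simpa using Finset.sum_le_sum (s := Finset.Ioi i) fun j _ => (hg (t s j)).2
    have h4 : ((Finset.Ioi i).card : ℝ) + 1 = (Finset.Ici i).card := by
      rw [← Finset.Ioi_insert i, Finset.card_insert_of_notMem (by simp)]
      push_cast
      rfl
    linarith
  · rw [isOpen_iff_mem_nhds]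
    intro s₀ (hs₀ : t s₀ i < c)
    obtain ⟨g, hg0, hg1, hg⟩ := exists_continuous_zero_one_of_isClosed (X := unitInterval)
      (isClosed_Ici (a := c)) (isClosed_Iic (a := t s₀ i))
      (Set.disjoint_left.2 fun x hx hx' => absurd (lt_of_le_of_lt (le_trans hx hx') hs₀) (lt_irrefl _))
    have h1 : ((Finset.Iic i).card : ℝ) ≤ ∑ j, g (t s₀ j) := by
      have : ∑ j ∈ Finset.Iic i, g (t s₀ j) = (Finset.Iic i).card := by
        rw [Finset.sum_congr rfl fun j hj => hg1 (ht s₀ (Finset.mem_Iic.1 hj))]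
        simp
      rw [← this]
      exact Finset.sum_le_sum_of_subset_of_nonneg (Finset.subset_univ _) fun j _ _ => (hg _).1
    have h2 := (h g).continuousAt.eventually (lt_mem_nhds
      (show ((Finset.Iic i).card : ℝ) - 1 < ∑ j, g (t s₀ j) by linarith))
    filter_upwards [h2] with s hs
    by_contra! hc
    have hc' : c ≤ t s i := not_lt.1 hc
    have h3 : ∑ j, g (t s j) ≤ ((Finset.Iio i).card : ℝ) := by
      have : ∑ j, g (t s j) = ∑ j ∈ Finset.Iio i, g (t s j) := by
        symm
        refine Finset.sum_subset (Finset.subset_univ _) fun j _ hj => hg0 ?_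
        rw [Finset.mem_Iio, not_lt] at hj
        exact hc'.trans (ht s hj)
      rw [this]
      simpa using Finset.sum_le_sum (s := Finset.Iio i) fun j _ => (hg (t s j)).2
    have h4 : ((Finset.Iio i).card : ℝ) + 1 = (Finset.Iic i).card := by
      rw [← Finset.Iio_insert i, Finset.card_insert_of_notMem (by simp)]
      push_cast
      rfl
    linarith

/-- Reduction modulo `q` determines `a`, reduction modulo `p` determines `b`, and then `k` follows
by cancellation. -/
theorem multiplicities_unique (hp : 0 < p) (hq : 0 < q) (hpq : p.Coprime q)
    {a b k a' b' k' : ℕ} (ha : a < q) (hb : b < p)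
    (ha' : a' < q) (hb' : b' < p)
    (h : p * a + (p * q * k + q * b) = p * a' + (p * q * k' + q * b')) :
    a = a' ∧ b = b' ∧ k = k' := by
  have h1 : a = a' := by
    have : p * a ≡ p * a' [MOD q] := by
      have := congrArg (· % q) h
      simpa [Nat.ModEq, Nat.add_mod, Nat.mul_mod, mul_assoc] using this
    exact Nat.ModEq.eq_of_lt_of_lt (Nat.ModEq.cancel_left_of_coprime hpq.symm this) ha ha'
  have h2 : b = b' := by
    have : q * b ≡ q * b' [MOD p] := by
      have := congrArg (· % p) h
      simpa [Nat.ModEq, Nat.add_mod, Nat.mul_mod, mul_assoc] using this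
    exact Nat.ModEq.eq_of_lt_of_lt (Nat.ModEq.cancel_left_of_coprime hpq this) hb hb'
  subst h1 h2
  refine ⟨rfl, rfl, ?_⟩
  have : p * q * k = p * q * k' := by omega
  exact Nat.eq_of_mul_eq_mul_left (Nat.mul_pos hp hq) this

/-- Every unital star homomorphism between dimension drop algebras has a normalized eigenvalue
pattern. -/
theorem exists_isNormalizedEigenvaluePattern (hp : 0 < p) (hq : 0 < q) (hpq : p.Coprime q)
    (φ : dimensionDrop p q →⋆ₐ[ℂ] dimensionDrop p' q') :
    ∃ (k : ℕ) (t : Fin k → C(unitInterval, unitInterval)), IsNormalizedEigenvaluePattern φ t := by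
  obtain ⟨a, b, k, t₀, ha, hb, -, h0⟩ := exists_hasBlocks hp hq ((evalAt 0).comp φ)
  have hall (s : unitInterval) : ∃ t : Fin k → unitInterval, Monotone t ∧
      HasBlocks hp hq ((evalAt s).comp φ) 1 (Fin a) (Fin k) (Fin b) t := by
    obtain ⟨a', b', k', t, ha', hb', htm, h⟩ := exists_hasBlocks hp hq ((evalAt s).comp φ)
    obtain ⟨rfl, rfl, rfl⟩ := multiplicities_unique hp hq hpq ha hb ha' hb'
      (h0.card_eq.trans h.card_eq.symm)
    exact ⟨t, htm, h⟩
  choose t htm ht using hall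
  obtain ⟨e⟩ : Nonempty ((Fin p × Fin a) ⊕ (((Fin p × Fin q) × Fin k) ⊕ (Fin q × Fin b)) ≃
      Fin p' × Fin q') := by
    refine Fintype.card_eq.1 ?_
    rw [← h0.card_eq]
    simp
  choose v hv using fun s => (ht s).exists_unitary e
  have htrace (h : C(unitInterval, ℂ)) (s : unitInterval) : ((φ (scalar h)).1 s).trace =
      p * a * h 0 + (p * q * ∑ i, h (t s i) + q * b * h 1) := by
    have := hv s (scalar h)
    rw [StarAlgHom.comp_apply, evalAt_apply] at this
    rw [this, trace_conj, trace_patternMatrix_scalar hp hq]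
    rfl
  have hcont (i : Fin k) : Continuous fun s => t s i := by
    refine continuous_of_continuous_sum htm (fun g => ?_) i
    -- The end blocks contribute constants to the trace; subtracting them isolates the eigenvalue
    -- sum.
    have h1 : (fun s => ∑ i, g (t s i)) = fun s => (((p : ℝ) * q)⁻¹ *
        ((((φ (scalar ⟨fun x => (g x : ℂ), by fun_prop⟩)).1 s).trace).re -
          p * a * g 0 - q * b * g 1)) := by
      funext s
      rw [htrace]
      have hp' : (p : ℝ) ≠ 0 := by exact_mod_cast hp.ne'
      have hq' : (q : ℝ) ≠ 0 := by exact_mod_cast hq.ne'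
      have : ((p : ℂ) * a * (g 0 : ℂ) + (p * q * ∑ i, (g (t s i) : ℂ) + q * b * (g 1 : ℂ))).re =
          p * a * g 0 + (p * q * ∑ i, g (t s i) + q * b * g 1) := by
        norm_cast
      simp only [ContinuousMap.coe_mk]
      rw [this]
      field_simp
      ring
    rw [h1]
    have h2 : Continuous fun s => ((φ (scalar ⟨fun x => (g x : ℂ), by fun_prop⟩)).1 s).trace :=
      Continuous.matrix_trace (map_continuous _)
    fun_prop
  exact ⟨k, fun i => ⟨fun s => t s i, hcont i⟩,
    ⟨a, b, ha, hb, e, v, fun f s => hv s f⟩, fun i j hij s => htm s hij⟩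

/-! ### Consequences of the existence of an eigenvalue pattern -/

section Pattern

variable {φ : dimensionDrop p q →⋆ₐ[ℂ] dimensionDrop p' q'}
  {t : Fin k → C(unitInterval, unitInterval)}

theorem conj_eq_zero_iff {n J : Type*} [Fintype n] [DecidableEq n]
    (v : Matrix.unitaryGroup n ℂ) (e : J ≃ n) (M : Matrix J J ℂ) :
    (v : Matrix n n ℂ) * Matrix.reindex e e M * (v : Matrix n n ℂ)ᴴ = 0 ↔ M = 0 := by
  have hv : (v : Matrix n n ℂ)ᴴ * v = 1 := Matrix.mem_unitaryGroup_iff'.1 v.2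
  constructor
  · intro h
    have h1 : Matrix.reindex e e M = (v : Matrix n n ℂ)ᴴ *
        ((v : Matrix n n ℂ) * Matrix.reindex e e M * (v : Matrix n n ℂ)ᴴ) * v := by
      rw [Matrix.mul_assoc (v : Matrix n n ℂ), ← Matrix.mul_assoc (v : Matrix n n ℂ)ᴴ, hv,
        Matrix.one_mul, Matrix.mul_assoc, hv, Matrix.mul_one]
    rw [h, Matrix.mul_zero, Matrix.zero_mul] at h1
    exact (Matrix.reindex e e).injective (h1.trans (by ext; simp))
  · rintro rfl
    rw [show Matrix.reindex e e (0 : Matrix J J ℂ) = 0 by ext; simp, Matrix.mul_zero,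
      Matrix.zero_mul]

theorem apply_pattern_eq_zero (h : IsEigenvaluePattern φ t) {f : dimensionDrop p q}
    {s : unitInterval} (hf : (φ f).1 s = 0) (i : Fin k) : f.1 (t i s) = 0 := by
  obtain ⟨a, b, -, -, e, v, hv⟩ := h
  rw [hv, conj_eq_zero_iff, patternMatrix, ← Matrix.fromBlocks_zero, Matrix.fromBlocks_inj,
    ← Matrix.fromBlocks_zero (m := _ × _) , Matrix.fromBlocks_inj] at hf
  have := hf.2.2.2.1
  rw [← Matrix.blockDiagonal_zero, Matrix.blockDiagonal_inj] at this
  exact congrFun this i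

/-- The end points enter because the blocks `c(f 0)` and `c(f 1)` may occur besides the eigenvalues.
-/
theorem map_apply_eq_zero (h : IsEigenvaluePattern φ t) {f : dimensionDrop p q}
    {s : unitInterval} (h0 : f.1 0 = 0) (h1 : f.1 1 = 0) (hf : ∀ i, f.1 (t i s) = 0) :
    (φ f).1 s = 0 := by
  obtain ⟨a, b, -, -, e, v, hv⟩ := h
  rw [hv, conj_eq_zero_iff, patternMatrix, h0, h1, leftFactor_zero, rightFactor_zero]
  simp only [hf]
  have h2 {o m : Type} [DecidableEq o] : Matrix.blockDiagonal (fun _ : o => (0 : Matrix m m ℂ)) = 0 :=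
    Matrix.blockDiagonal_zero
  rw [h2, h2, h2, Matrix.fromBlocks_zero, Matrix.fromBlocks_zero]

theorem exists_trace_eq (h : IsEigenvaluePattern φ t) : ∃ a b : ℕ, a < q ∧ b < p ∧
    p * a + (p * q * k + q * b) = p' * q' ∧
    ∀ (f : dimensionDrop p q) (s : unitInterval), ((φ f).1 s).trace =
      a * (leftFactor (f.1 0)).trace +
      (∑ i, (f.1 (t i s)).trace + b * (rightFactor (f.1 1)).trace) := by
  obtain ⟨a, b, ha, hb, e, v, hv⟩ := h
  refine ⟨a, b, ha, hb, ?_, fun f s => by rw [hv, trace_conj, trace_patternMatrix]⟩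
  have := Fintype.card_congr e
  simpa using this

end Pattern

end DimensionDrop

/-! ### Projections and injectivity of the connecting maps. -/

namespace DimensionDrop

theorem exists_nat_trace_eq {n : Type*} [Fintype n] [DecidableEq n] {M : Matrix n n ℂ}
    (hM : M * M = M) : ∃ r : ℕ, M.trace = r := by
  have h : IsIdempotentElem (Matrix.toLin' M) := by
    change Matrix.toLin' M ∘ₗ Matrix.toLin' M = Matrix.toLin' M
    rw [← Matrix.toLin'_mul, hM]
  have := (LinearMap.isProj_range_iff_isIdempotentElem _).2 h
  exact ⟨_, (Matrix.trace_toLin'_eq M).symm.trans this.trace⟩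

variable {p q p' q' k : ℕ}

/-- The rank of a projection in a prime dimension drop algebra is divisible by the size. -/
theorem mul_dvd_of_trace_eq (hp : 0 < p) (hq : 0 < q) (hpq : p.Coprime q)
    {g : dimensionDrop p q} (hg : g * g = g) {d : ℕ} (hd : ∀ s, (g.1 s).trace = d) :
    p * q ∣ d := by
  -- At the right end the value is `1 ⊗ c` with `c` idempotent, so the trace is `p` times an integer
  -- rank; the left end gives the factor `q`.
  refine hpq.mul_dvd_of_dvd_of_dvd ?_ ?_
  · obtain ⟨r, hr⟩ := exists_nat_trace_eq (M := evalRight hp g) (by rw [← map_mul, hg])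
    rw [evalRight_apply] at hr
    have := hd 1
    rw [apply_one_eq hp, Matrix.trace_kronecker, Matrix.trace_one, hr, Fintype.card_fin] at this
    exact ⟨r, by exact_mod_cast this.symm⟩
  · obtain ⟨r, hr⟩ := exists_nat_trace_eq (M := evalLeft hq g) (by rw [← map_mul, hg])
    rw [evalLeft_apply] at hr
    have := hd 0
    rw [apply_zero_eq hq, Matrix.trace_kronecker, Matrix.trace_one, hr, Fintype.card_fin,
      mul_comm] at this
    exact ⟨r, by exact_mod_cast this.symm⟩

variable {φ : dimensionDrop p q →⋆ₐ[ℂ] dimensionDrop p' q'}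
  {t : Fin k → C(unitInterval, unitInterval)}

theorem map_sub' (φ : dimensionDrop p q →⋆ₐ[ℂ] dimensionDrop p' q') (f g : dimensionDrop p q) :
    φ (f - g) = φ f - φ g := ext' fun s => hom_sub ((evalAt s).comp φ) f g

/-- The image `φ f` sees `f` only at the end points and along the eigenvalue functions. Away from
these `f` may fail to be idempotent, so a continuous function can act as the indicator of one side
of a gap. -/
theorem map_mul_self (h : IsEigenvaluePattern φ t) {f : dimensionDrop p q}
    (h0 : f.1 0 * f.1 0 = f.1 0) (h1 : f.1 1 * f.1 1 = f.1 1)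
    (hf : ∀ i s, f.1 (t i s) * f.1 (t i s) = f.1 (t i s)) : φ f * φ f = φ f := by
  rw [← sub_eq_zero, ← map_mul, ← map_sub']
  refine ext' fun s => map_apply_eq_zero h ?_ ?_ fun i => ?_
  · rw [coe_sub, coe_mul, h0, sub_self]
  · rw [coe_sub, coe_mul, h1, sub_self]
  · rw [coe_sub, coe_mul, hf, sub_self]

theorem single_mul_self {n : Type*} [Fintype n] [DecidableEq n] (i : n) :
    (Matrix.single i i (1 : ℂ)) * Matrix.single i i 1 = Matrix.single i i 1 := by
  rw [Matrix.single_mul_single_same, one_mul]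

/-- The eigenvalue functions of a homomorphism from a dimension drop algebra with no full matrix
fibre at an end point to a prime one hit every interior point. -/
theorem exists_pattern_apply_eq (hp : 1 < p) (hq : 1 < q) (hp' : 0 < p') (hq' : 0 < q')
    (hpq' : p'.Coprime q') (h : IsEigenvaluePattern φ t) {y : unitInterval} (hy0 : 0 < y)
    (hy1 : y < 1) : ∃ i s, t i s = y := by
  by_contra! H
  obtain ⟨a, b, -, -, hN, htr⟩ := exists_trace_eq h
  set C : Set unitInterval := {0, 1} ∪ ⋃ i, Set.range (t i) with hC
  have hCc : IsClosed C := ((Set.toFinite {0, 1}).isClosed).union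
    (isClosed_iUnion_of_finite fun i => (isCompact_range (t i).continuous).isClosed)
  have hyC : y ∉ C := by
    simp only [hC, Set.mem_union, Set.mem_insert_iff, Set.mem_singleton_iff, Set.mem_iUnion,
      Set.mem_range, not_or, not_exists]
    exact ⟨⟨hy0.ne', hy1.ne⟩, H⟩
  obtain ⟨g, hg0, hg1, -⟩ := exists_continuous_zero_one_of_isClosed (X := unitInterval)
    (hCc.inter (isClosed_Ici (a := y))) (hCc.inter (isClosed_Iic (a := y)))
    (Set.disjoint_left.2 fun x hx hx' => hyC (le_antisymm (Set.mem_Iic.1 hx'.2) (Set.mem_Ici.1 hx.2) ▸ hx.1))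
  set G : C(unitInterval, ℂ) := ⟨fun x => (g x : ℂ), by fun_prop⟩ with hG
  have hG0 : G 0 = 1 := by
    have := hg1 (x := 0) ⟨by simp [hC], hy0.le⟩
    simp [hG, this]
  have hG1 : G 1 = 0 := by
    have := hg0 (x := 1) ⟨by simp [hC], hy1.le⟩
    simp [hG, this]
  -- No eigenvalue function takes the value `y`, so each stays on one side of it; `e i` records
  -- whether that is the left side.
  set e : Fin k → ℕ := fun i => if t i 0 < y then 1 else 0 with he
  have hGt (i s) : G (t i s) = e i := by
    have hmem : t i s ∈ C := Or.inr (Set.mem_iUnion.2 ⟨i, s, rfl⟩)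
    have hivt {c d : unitInterval} (hc : t i c ≤ y) (hd : y ≤ t i d) : False := by
      obtain ⟨z, hz⟩ := mem_range_of_exists_le_of_exists_ge (t i).continuous ⟨c, hc⟩ ⟨d, hd⟩
      exact H i z hz
    by_cases h0 : t i 0 < y
    · have : t i s ≤ y := by
        by_contra! hlt
        exact hivt h0.le hlt.le
      have := hg1 (x := t i s) ⟨hmem, this⟩
      simp [hG, he, h0, this]
    · have : y ≤ t i s := by
        by_contra! hlt
        exact hivt hlt.le (not_lt.1 h0)
      have := hg0 (x := t i s) ⟨hmem, this⟩
      simp [hG, he, h0, this]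
  have heK : ∑ i, e i ≤ k := by
    calc ∑ i, e i ≤ ∑ _i : Fin k, 1 := Finset.sum_le_sum fun i _ => by
          simp only [he]; split_ifs <;> simp
      _ = k := by simp
  have hee (i) : (e i : ℂ) * e i = e i := by simp only [he]; split_ifs <;> simp
  have hdvd : p' * q' ∣ p * a + p * q * ∑ i, e i := by
    refine mul_dvd_of_trace_eq hp' hq' hpq' (g := φ (scalar G)) (map_mul_self h ?_ ?_ ?_) ?_
    · simp [hG0]
    · simp [hG1]
    · intro i s
      simp [hGt, smul_smul, hee]
    · intro s
      rw [htr]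
      simp only [scalar_apply, leftFactor_smul, rightFactor_smul, leftFactor_one (by omega : 0 < q),
        rightFactor_one (by omega : 0 < p), Matrix.trace_smul, Matrix.trace_one, Fintype.card_fin,
        Fintype.card_prod, smul_eq_mul, ← Finset.sum_mul, hG0, hG1, hGt]
      push_cast
      ring
  have hN0 : 0 < p' * q' := Nat.mul_pos hp' hq'
  have hle : p * q * ∑ i, e i ≤ p * q * k := Nat.mul_le_mul_left _ heK
  -- The trace of the cut projection is a multiple of `p'q'` and at most `p'q'`, so everything lies
  -- on one side of `y`.
  rcases Nat.eq_zero_or_pos (p * a + p * q * ∑ i, e i) with hz | hpos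
  · have ha : a = 0 := by
      have : p * a = 0 := by omega
      rcases Nat.mul_eq_zero.1 this with h | h <;> omega
    have he0 (i) : e i = 0 := by
      have h1 : p * q * ∑ i, e i = 0 := by omega
      have h2 : ∑ i, e i = 0 := by
        rcases Nat.mul_eq_zero.1 h1 with h | h
        · exact absurd h (Nat.mul_pos (by omega) (by omega)).ne'
        · exact h
      exact Finset.sum_eq_zero_iff.1 h2 i (Finset.mem_univ i)
    have j : Fin q := ⟨0, by omega⟩
    -- With everything on the right, a rank one projection of `M_q` extends past the gap by `0`. Its
    -- image has trace `pk + b = p'q' / q`, nonzero and less than `p'q'` because `q ≥ 2`.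
    have hd : p' * q' ∣ p * k + b := by
      refine mul_dvd_of_trace_eq hp' hq' hpq' (g := φ (smulConst (1 - G)
        ((1 : Matrix (Fin p) (Fin p) ℂ) ⊗ₖ Matrix.single j j 1)
        ⟨0, by simp [hG0]⟩ ⟨Matrix.single j j 1, by simp [hG1]⟩)) (map_mul_self h ?_ ?_ ?_) ?_
      · simp [hG0]
      · simp only [smulConst_apply, ContinuousMap.sub_apply, ContinuousMap.one_apply, hG1, sub_zero,
          one_smul]
        rw [← Matrix.mul_kronecker_mul, one_mul, single_mul_self]
      · intro i s
        simp only [smulConst_apply, ContinuousMap.sub_apply, ContinuousMap.one_apply, hGt, he0,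
          Nat.cast_zero, sub_zero, one_smul]
        rw [← Matrix.mul_kronecker_mul, one_mul, single_mul_self]
      · intro s
        rw [htr]
        simp only [smulConst_apply, ContinuousMap.sub_apply, ContinuousMap.one_apply, hG1, sub_zero,
          one_smul, ha, Nat.cast_zero, zero_mul, zero_add, hGt, he0]
        rw [rightFactor_one_kronecker (by omega), Matrix.trace_kronecker, Matrix.trace_single_eq_same,
          Matrix.trace_one]
        simp
        ring
    have h1 : p * k + b ≠ 0 := by
      intro h0
      have : p * a + (p * q * k + q * b) = q * (p * k + b) := by rw [ha]; ring
      rw [h0] at this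
      omega
    have h2 := Nat.le_of_dvd (Nat.pos_of_ne_zero h1) hd
    rw [← hN, ha] at h2
    have h3 : p * 0 + (p * q * k + q * b) = q * (p * k + b) := by ring
    rw [h3] at h2
    have h4 : 2 * (p * k + b) ≤ q * (p * k + b) := Nat.mul_le_mul_right _ hq
    omega
  · have hge := Nat.le_of_dvd hpos hdvd
    have hb : b = 0 := by
      have : q * b = 0 := by omega
      rcases Nat.mul_eq_zero.1 this with h | h <;> omega
    have heK' : ∑ i, e i = k := by
      have : p * q * ∑ i, e i = p * q * k := by omega
      exact Nat.eq_of_mul_eq_mul_left (Nat.mul_pos (by omega) (by omega)) this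
    have he1 (i) : e i = 1 := by
      have hle (i) : e i ≤ 1 := by simp only [he]; split_ifs <;> simp
      have : ∑ i, e i = ∑ _i : Fin k, 1 := by simp [heK']
      exact (Finset.sum_eq_sum_iff_of_le fun i _ => hle i).1 this i (Finset.mem_univ i)
    have j : Fin p := ⟨0, by omega⟩
    -- The mirror image, with a rank one projection of `M_p` and trace `p'q' / p`.
    have hd : p' * q' ∣ a + q * k := by
      refine mul_dvd_of_trace_eq hp' hq' hpq' (g := φ (smulConst G
        (Matrix.single j j 1 ⊗ₖ (1 : Matrix (Fin q) (Fin q) ℂ))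
        ⟨Matrix.single j j 1, by simp [hG0]⟩ ⟨0, by simp [hG1]⟩)) (map_mul_self h ?_ ?_ ?_) ?_
      · simp only [smulConst_apply, hG0, one_smul]
        rw [← Matrix.mul_kronecker_mul, one_mul, single_mul_self]
      · simp [hG1]
      · intro i s
        simp only [smulConst_apply, hGt, he1, Nat.cast_one, one_smul]
        rw [← Matrix.mul_kronecker_mul, one_mul, single_mul_self]
      · intro s
        rw [htr]
        simp only [smulConst_apply, hG0, one_smul, hb, Nat.cast_zero, zero_mul, add_zero, hGt, he1,
          Nat.cast_one]
        rw [leftFactor_kronecker_one (by omega), Matrix.trace_kronecker,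
          Matrix.trace_single_eq_same, Matrix.trace_one]
        simp
        ring
    have h1 : a + q * k ≠ 0 := by
      intro h0
      have : p * a + (p * q * k + q * b) = p * (a + q * k) := by rw [hb]; ring
      rw [h0] at this
      omega
    have h2 := Nat.le_of_dvd (Nat.pos_of_ne_zero h1) hd
    rw [← hN, hb] at h2
    have h3 : p * a + (p * q * k + q * 0) = p * (a + q * k) := by ring
    rw [h3] at h2
    have h4 : 2 * (a + q * k) ≤ p * (a + q * k) := Nat.mul_le_mul_right _ hp
    omega

theorem dense_Ioo_unitInterval : Dense (Set.Ioo (0 : unitInterval) 1) := by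
  rw [dense_iff_closure_eq, closure_Ioo zero_ne_one]
  exact Set.eq_univ_of_forall fun x => ⟨x.2.1, x.2.2⟩

theorem eq_zero_of_forall_Ioo {f : dimensionDrop p q}
    (h : ∀ y : unitInterval, 0 < y → y < 1 → f.1 y = 0) : f = 0 := by
  refine ext' fun s => ?_
  have := Continuous.ext_on dense_Ioo_unitInterval f.1.continuous (continuous_const (y := 0))
    fun y hy => h y hy.1 hy.2
  exact congrFun this s

/-- Unital homomorphisms between dimension drop algebras are injective if both matrix sizes of the
domain are at least two. -/
theorem injective_of_one_lt (hp : 1 < p) (hq : 1 < q) (hp' : 0 < p') (hq' : 0 < q')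
    (hpq' : p'.Coprime q') (h : IsEigenvaluePattern φ t) : Function.Injective φ := by
  intro f g hfg
  rw [← sub_eq_zero]
  refine eq_zero_of_forall_Ioo fun y hy0 hy1 => ?_
  obtain ⟨i, s, rfl⟩ := exists_pattern_apply_eq hp hq hp' hq' hpq' h hy0 hy1
  refine apply_pattern_eq_zero h ?_ i
  rw [map_sub', coe_sub, hfg, sub_self]

/-- Without eigenvalue functions only the end points matter, and `s(1 - s)` is killed. -/
theorem pos_of_injective (hp : 0 < p) (hq : 0 < q)
    (h : IsEigenvaluePattern φ t) (hφ : Function.Injective φ) : 0 < k := by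
  by_contra! hk
  obtain rfl : k = 0 := by omega
  have h1 : φ (scalar (coord * (1 - coord))) = 0 := ext' fun s =>
    map_apply_eq_zero h (by simp) (by simp) fun i => i.elim0
  have h2 : scalar (p := p) (q := q) (coord * (1 - coord)) = 0 :=
    hφ (h1.trans (map_zero φ).symm)
  have h3 := congrArg (fun f : dimensionDrop p q =>
    f.1 ⟨1 / 2, by norm_num, by norm_num⟩ (⟨0, hp⟩, ⟨0, hq⟩) (⟨0, hp⟩, ⟨0, hq⟩)) h2
  norm_num at h3

end DimensionDrop

/-! ### Hereditary closed ideals and approximation. -/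

section Hereditary

theorem eq_zero_of_mul_mul_self {B : Type*} [CStarAlgebra B] {p : B} (hp : IsSelfAdjoint p) (h : p * p * p = 0) : p = 0 := by
  have h2 : IsSelfAdjoint (p * p) := by
    rw [IsSelfAdjoint, star_mul, hp.star_eq]
  have h3 : p * p = 0 := by
    rw [← CStarRing.star_mul_self_eq_zero_iff, h2.star_eq, ← mul_assoc, h, zero_mul]
  rwa [← CStarRing.star_mul_self_eq_zero_iff, hp.star_eq]

variable {B : Type*} [CStarAlgebra B] [PartialOrder B] [StarOrderedRing B]

/-- The witness is `(z + δ)⁻¹`; the norm bound is `x / (x + δ)² ≤ 1 / δ` for `x ≥ 0`. -/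
theorem exists_resolvent {z : B} (hz0 : 0 ≤ z) {δ : ℝ} (hδ0 : 0 < δ) :
    ∃ e : B, star e = e ∧ 1 - z * e = δ • e ∧ ‖e * z * e‖ ≤ 1 / δ := by
  have hspec : ∀ x ∈ spectrum ℝ z, 0 ≤ x := fun x hx => spectrum_nonneg_of_nonneg hz0 hx
  have hzs : IsSelfAdjoint z := hz0.isSelfAdjoint
  have hcont : ContinuousOn (fun x : ℝ => (x + δ)⁻¹) (spectrum ℝ z) :=
    ContinuousOn.inv₀ (by fun_prop) fun x hx => by have := hspec x hx; positivity
  have hid : ContinuousOn (fun x : ℝ => x) (spectrum ℝ z) := continuousOn_id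
  have hprod : ContinuousOn (fun x : ℝ => x * (x + δ)⁻¹) (spectrum ℝ z) := hid.mul hcont
  have hze : z * cfc (fun x : ℝ => (x + δ)⁻¹) z = cfc (fun x : ℝ => x * (x + δ)⁻¹) z := by
    rw [cfc_mul (fun x : ℝ => x) (fun x : ℝ => (x + δ)⁻¹) z hid hcont, cfc_id' ℝ z]
  refine ⟨cfc (fun x : ℝ => (x + δ)⁻¹) z, IsSelfAdjoint.cfc, ?_, ?_⟩
  · rw [hze, ← cfc_const_mul δ _ z hcont, ← cfc_one ℝ z,
      ← cfc_sub (1 : ℝ → ℝ) _ z continuousOn_const hprod]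
    refine cfc_congr fun x hx => ?_
    have := hspec x hx
    have : x + δ ≠ 0 := by positivity
    simp only [Pi.one_apply]
    field_simp
    ring
  · rw [mul_assoc, hze, ← cfc_mul _ _ z hcont hprod]
    refine norm_cfc_le (by positivity) fun x hx => ?_
    have hx0 := hspec x hx
    rw [Real.norm_of_nonneg (by positivity)]
    have : (x + δ)⁻¹ * (x * (x + δ)⁻¹) = x / (x + δ) ^ 2 := by field_simp
    rw [this, div_le_div_iff₀ (by positivity) hδ0]
    nlinarith

/-- Closed two-sided ideals of a C⋆-algebra are hereditary. -/
theorem TwoSidedIdeal.mem_of_nonneg_of_le {I : TwoSidedIdeal B} (hI : IsClosed (I : Set B))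
    {w z : B} (hw : 0 ≤ w) (hwz : w ≤ z) (hz : z ∈ I) : w ∈ I := by
  set s := CFC.sqrt w with hs
  have hss : s * s = w := CFC.sqrt_mul_sqrt_self w hw
  have hsa : star s = s := (CFC.sqrt_nonneg w).isSelfAdjoint
  suffices hsI : s ∈ I by
    rw [← hss]
    exact I.mul_mem_left _ _ hsI
  have hmem : s ∈ closure (I : Set B) := by
    rw [Metric.mem_closure_iff]
    intro ε hε
    -- The error `s - s * (z * e) = δ • (s * e)` has squared norm `δ² ‖e * w * e‖ ≤ δ² ‖e * z * e‖ ≤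
    -- δ`.
    set δ : ℝ := ε ^ 2 / 4 with hδ
    have hδ0 : 0 < δ := by positivity
    obtain ⟨e, hea, hze, h4⟩ := exists_resolvent (hw.trans hwz) hδ0
    refine ⟨s * (z * e), I.mul_mem_left _ _ (I.mul_mem_right _ _ hz), ?_⟩
    have h3 : s - s * (z * e) = δ • (s * e) := by
      rw [← mul_smul_comm, ← hze, mul_sub, mul_one]
    have h6 : ‖s * e‖ * ‖s * e‖ ≤ 1 / δ := by
      rw [← CStarRing.norm_star_mul_self, star_mul, hea, hsa]
      have h7 : e * s * (s * e) = e * w * e := by rw [← hss]; noncomm_ring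
      rw [h7]
      have h8 : 0 ≤ e * w * e := by
        have := star_left_conjugate_nonneg hw e
        rwa [hea] at this
      have h9 : e * w * e ≤ e * z * e := by
        have := star_left_conjugate_le_conjugate hwz e
        rwa [hea] at this
      exact (CStarAlgebra.norm_le_norm_of_nonneg_of_le h8 h9).trans h4
    rw [dist_eq_norm, h3, norm_smul, Real.norm_of_nonneg hδ0.le]
    have h10 : (δ * ‖s * e‖) ^ 2 ≤ δ := by
      have : (δ * ‖s * e‖) ^ 2 = δ ^ 2 * (‖s * e‖ * ‖s * e‖) := by ring
      rw [this]
      calc δ ^ 2 * (‖s * e‖ * ‖s * e‖) ≤ δ ^ 2 * (1 / δ) := by gcongr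
        _ = δ := by field_simp
    have h11 : (δ * ‖s * e‖) ^ 2 < ε ^ 2 := by
      have : δ < ε ^ 2 := by rw [hδ]; linarith [sq_pos_of_pos hε]
      linarith
    exact lt_of_pow_lt_pow_left₀ 2 hε.le h11
  rwa [hI.closure_eq] at hmem

/-- A closed ideal containing a nonzero positive element near the image of a self-adjoint element
contains a nonzero element of the image. -/
theorem TwoSidedIdeal.exists_map_mem {A : Type*} [CStarAlgebra A] (μ : A →⋆ₐ[ℂ] B)
    {I : TwoSidedIdeal B} (hI : IsClosed (I : Set B)) {y : B} (hy : y ∈ I) (hy0 : 0 ≤ y)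
    {a : A} (ha : IsSelfAdjoint a) (hay : 2 * ‖μ a - y‖ < ‖y‖) : ∃ w, μ w ∈ I ∧ μ w ≠ 0 := by
  let := CStarAlgebra.spectralOrder A
  have := CStarAlgebra.spectralOrderedRing A
  set δ := ‖μ a - y‖ with hδ
  -- Shifting by `δ` gives `μ h ≤ y ≤ μ h + 2δ`. The left inequality places the image of `h⁺ * h *
  -- h⁺ = (h⁺)³` in `I` by heredity; the right one, with `2δ < ‖y‖`, keeps it nonzero.
  set h : A := a - algebraMap ℝ A δ with hh
  have hsa : IsSelfAdjoint h := ha.sub (IsSelfAdjoint.algebraMap A (.all δ))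
  have hdec : h⁺ - h⁻ = h := CFC.posPart_sub_negPart h hsa
  have hpn : h⁺ * h⁻ = 0 := CFC.posPart_mul_negPart h
  have hμ {x : A} (hx : 0 ≤ x) : 0 ≤ μ x := by
    rw [CStarAlgebra.nonneg_iff_eq_star_mul_self] at hx
    obtain ⟨c, rfl⟩ := hx
    rw [map_mul, map_star]
    exact star_mul_self_nonneg _
  have hP := hμ (CFC.posPart_nonneg h)
  have hPs : IsSelfAdjoint (μ h⁺) := hP.isSelfAdjoint
  have hμh : μ h = μ a - algebraMap ℝ B δ := by
    rw [hh, map_sub]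
    congr 1
    rw [Algebra.algebraMap_eq_smul_one, Algebra.algebraMap_eq_smul_one, ← Complex.coe_smul,
      ← Complex.coe_smul, map_smul, map_one]
  have hysa : IsSelfAdjoint (μ a - y) := (ha.map μ).sub hy0.isSelfAdjoint
  have hle1 : μ h ≤ y := by
    rw [hμh, sub_le_iff_le_add, ← sub_le_iff_le_add']
    exact hysa.le_algebraMap_norm_self
  have hle2 : y ≤ μ h + algebraMap ℝ B (2 * δ) := by
    have h1 := hysa.neg_algebraMap_norm_le_self
    rw [hμh, two_mul, map_add]
    rw [← hδ, neg_le_sub_iff_le_add] at h1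
    calc y ≤ μ a + algebraMap ℝ B δ := h1
      _ = _ := by abel
  have hw : μ (h⁺ * h * h⁺) = μ h⁺ * μ h⁺ * μ h⁺ := by
    have : h⁺ * h * h⁺ = h⁺ * h⁺ * h⁺ := by
      rw [← sub_eq_zero]
      have : h⁺ * h * h⁺ - h⁺ * h⁺ * h⁺ = h⁺ * (h - h⁺) * h⁺ := by noncomm_ring
      rw [this]
      have : h - h⁺ = - h⁻ := by
        nth_rewrite 1 [← hdec]
        abel
      rw [this, mul_neg, hpn, neg_zero, zero_mul]
    rw [this, map_mul, map_mul]
  refine ⟨h⁺ * h * h⁺, ?_, fun h0 => ?_⟩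
  · have hz : μ h⁺ * y * μ h⁺ ∈ I := I.mul_mem_right _ _ (I.mul_mem_left _ _ hy)
    refine TwoSidedIdeal.mem_of_nonneg_of_le hI ?_ ?_ hz
    · rw [hw]
      have := star_left_conjugate_nonneg hP (μ h⁺)
      rwa [hPs.star_eq] at this
    · rw [map_mul, map_mul]
      have := star_left_conjugate_le_conjugate hle1 (μ h⁺)
      rwa [hPs.star_eq] at this
  · rw [hw] at h0
    have hP0 := eq_zero_of_mul_mul_self hPs h0
    have hh0 : μ h ≤ 0 := by
      rw [← hdec, map_sub, hP0, zero_sub, neg_nonpos]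
      exact hμ (CFC.negPart_nonneg h)
    have : y ≤ algebraMap ℝ B (2 * δ) := hle2.trans (by simpa using hh0)
    have := (CStarAlgebra.norm_le_iff_le_algebraMap y (by positivity) hy0).2 this
    linarith

end Hereditary

/-! ### Closed ideals of an inductive limit. -/

namespace CStarLimit

variable {A : ℕ → Type*} [∀ n, CStarAlgebra (A n)]
  (ι : ∀ m n, m ≤ n → A m →⋆ₐ[ℂ] A n) [DirectedSystem A (ι · · ·)]

theorem coe_mk_one (m : ℕ) : coe ι (AlgLimit.mk ι m 1) = 1 := by
  have : AlgLimit.mk ι m 1 = 1 := (DirectLimit.one_def m).symm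
  rw [this]
  exact UniformSpace.Completion.coe_one _

/-- The canonical star homomorphism into the inductive limit. -/
noncomputable def of (m : ℕ) : A m →⋆ₐ[ℂ] CStarLimit A ι where
  toFun a := coe ι (AlgLimit.mk ι m a)
  map_one' := coe_mk_one ι m
  map_mul' a b := by rw [← AlgLimit.mk_mul, coe_mul]
  map_zero' := by
    rw [AlgLimit.mk_zero]
    exact UniformSpace.Completion.coe_zero
  map_add' a b := by rw [← AlgLimit.mk_add, coe_add]
  commutes' r := by
    rw [Algebra.algebraMap_eq_smul_one, Algebra.algebraMap_eq_smul_one, ← AlgLimit.mk_smul,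
      coe_smul, coe_mk_one]
  map_star' a := by rw [star_coe, AlgLimit.star_mk]

theorem of_map (m n : ℕ) (h : m ≤ n) (a : A m) : of ι n (ι m n h a) = of ι m a :=
  congrArg (coe ι) (AlgLimit.mk_map ι m n h a)

/-- Injective star homomorphisms of C⋆-algebras are isometric, so all representatives of a class
have the same norm. -/
theorem norm_of (hι : ∀ m n h, Function.Injective (ι m n h)) (m : ℕ) (a : A m) :
    ‖of ι m a‖ = ‖a‖ := by
  refine (norm_coe ι _).trans (le_antisymm (AlgLimit.norm_mk_le ι m a) ?_)
  refine AlgLimit.le_norm ι fun n b hb => ?_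
  obtain ⟨l, h, h', hl⟩ := (AlgLimit.mk_eq_mk ι).1 hb
  rw [← NonUnitalStarAlgHom.norm_map _ (hι m l h') a, ← NonUnitalStarAlgHom.norm_map _ (hι n l h) b,
    hl]

theorem continuous_of (hι : ∀ m n h, Function.Injective (ι m n h)) (m : ℕ) :
    Continuous (of ι m) :=
  (AddMonoidHomClass.isometry_of_norm (of ι m) (norm_of ι hι m)).continuous

theorem isClosed_preimage_of (hι : ∀ m n h, Function.Injective (ι m n h)) (m : ℕ)
    {I : TwoSidedIdeal (CStarLimit A ι)} (hI : IsClosed (I : Set (CStarLimit A ι))) :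
    IsClosed {a | of ι m a ∈ I} :=
  hI.preimage (continuous_of ι hι m)

theorem of_zero_mem (I : TwoSidedIdeal (CStarLimit A ι)) (m : ℕ) : of ι m 0 ∈ I := by
  rw [map_zero]
  exact I.zero_mem

theorem of_add_mem {I : TwoSidedIdeal (CStarLimit A ι)} {m : ℕ} {a b : A m} (ha : of ι m a ∈ I)
    (hb : of ι m b ∈ I) : of ι m (a + b) ∈ I := by
  rw [map_add]
  exact I.add_mem ha hb

theorem exists_norm_of_sub_lt (x : CStarLimit A ι) {ε : ℝ} (hε : 0 < ε) :
    ∃ m a, ‖of ι m a - x‖ < ε := by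
  obtain ⟨y, hy⟩ := Metric.denseRange_iff.1 (denseRange_coe ι) x ε hε
  obtain ⟨m, a, rfl⟩ := AlgLimit.exists_mk ι y
  exact ⟨m, a, by rwa [dist_comm, dist_eq_norm] at hy⟩

theorem mem_closure_of (x : CStarLimit A ι) : x ∈ closure {x | ∃ m a, of ι m a = x} := by
  rw [Metric.mem_closure_iff]
  intro ε hε
  obtain ⟨m, a, h⟩ := exists_norm_of_sub_lt ι x hε
  exact ⟨_, ⟨m, a, rfl⟩, by rwa [dist_comm, dist_eq_norm]⟩

/-- Closed ideals of an inductive limit are detected at the finite stages. -/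
theorem exists_of_mem {I : TwoSidedIdeal (CStarLimit A ι)}
    (hI : IsClosed (I : Set (CStarLimit A ι))) (hI0 : I ≠ ⊥) :
    ∃ m a, of ι m a ∈ I ∧ of ι m a ≠ 0 := by
  let := CStarAlgebra.spectralOrder (CStarLimit A ι)
  have := CStarAlgebra.spectralOrderedRing (CStarLimit A ι)
  obtain ⟨x, hx, hx0⟩ : ∃ x ∈ I, x ≠ 0 := by
    by_contra! H
    exact hI0 (eq_bot_iff.2 fun x hx => (TwoSidedIdeal.mem_bot _).2 (H x hx))
  set y := star x * x with hy
  have hyI : y ∈ I := I.mul_mem_left _ _ hx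
  have hypos : 0 < ‖y‖ := by
    rw [hy, norm_pos_iff, Ne, CStarRing.star_mul_self_eq_zero_iff]
    exact hx0
  have hys : star y = y := by rw [hy, star_mul, star_star]
  obtain ⟨m, a, ha⟩ := exists_norm_of_sub_lt ι y (ε := ‖y‖ / 2) (by positivity)
  -- Taking the self-adjoint part does not increase the distance to the self-adjoint `y`.
  set b : A m := (1 / 2 : ℝ) • (a + star a) with hb
  have hbs : IsSelfAdjoint b := by
    rw [IsSelfAdjoint, hb, star_smul, star_add, star_star, add_comm]
    simp
  have hby : ‖of ι m b - y‖ < ‖y‖ / 2 := by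
    have h1 : of ι m b - y = (1 / 2 : ℝ) • ((of ι m a - y) + star (of ι m a - y)) := by
      rw [hb, ← Complex.coe_smul, map_smul, map_add, map_star, star_sub, hys, Complex.coe_smul]
      module
    rw [h1, norm_smul]
    have h2 := norm_add_le (of ι m a - y) (star (of ι m a - y))
    rw [norm_star] at h2
    rw [Real.norm_of_nonneg (by norm_num)]
    linarith
  obtain ⟨w, hw, hw0⟩ := TwoSidedIdeal.exists_map_mem (of ι m) hI hyI (star_mul_self_nonneg x) hbs
    (by linarith)
  exact ⟨m, w, hw, hw0⟩

/-- Compatible ideals at the finite stages generate a closed ideal of the inductive limit. -/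
theorem exists_ideal {S : ∀ m, A m → Prop} (hzero : ∀ m, S m 0)
    (hadd : ∀ {m a b}, S m a → S m b → S m (a + b))
    (hleft : ∀ {m a} b, S m a → S m (b * a)) (hright : ∀ {m a} b, S m a → S m (a * b))
    (hmap : ∀ {m a} n h, S m a → S n (ι m n h a)) :
    ∃ I : TwoSidedIdeal (CStarLimit A ι),
      (I : Set (CStarLimit A ι)) = closure {x | ∃ m a, S m a ∧ of ι m a = x} := by
  set T : Set (CStarLimit A ι) := {x | ∃ m a, S m a ∧ of ι m a = x} with hT
  have hTl {x y} (hx : x ∈ {x | ∃ m a, of ι m a = x}) (hy : y ∈ T) : x * y ∈ T := by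
    obtain ⟨m, a, rfl⟩ := hx
    obtain ⟨n, b, hb, rfl⟩ := hy
    refine ⟨max m n, ι m _ (le_max_left _ _) a * ι n _ (le_max_right _ _) b,
      hleft _ (hmap _ _ hb), ?_⟩
    rw [map_mul, of_map, of_map]
  have hTr {x y} (hx : x ∈ T) (hy : y ∈ {x | ∃ m a, of ι m a = x}) : x * y ∈ T := by
    obtain ⟨n, b, hb, rfl⟩ := hx
    obtain ⟨m, a, rfl⟩ := hy
    refine ⟨max m n, ι n _ (le_max_right _ _) b * ι m _ (le_max_left _ _) a,
      hright _ (hmap _ _ hb), ?_⟩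
    rw [map_mul, of_map, of_map]
  refine ⟨TwoSidedIdeal.mk' (closure T) (subset_closure ⟨0, 0, hzero 0, map_zero _⟩)
    (fun {x y} hx hy => map_mem_closure₂ continuous_add hx hy ?_)
    (fun {x} hx => map_mem_closure continuous_neg hx ?_)
    (fun {x y} hy => map_mem_closure₂ continuous_mul (mem_closure_of ι x) hy fun _ h _ h' => hTl h h')
    (fun {x y} hx => map_mem_closure₂ continuous_mul hx (mem_closure_of ι y)
      fun _ h _ h' => hTr h h'), ?_⟩
  · rintro _ ⟨m, a, ha, rfl⟩ _ ⟨n, b, hb, rfl⟩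
    refine ⟨max m n, ι m _ (le_max_left _ _) a + ι n _ (le_max_right _ _) b,
      hadd (hmap _ _ ha) (hmap _ _ hb), ?_⟩
    rw [map_add, of_map, of_map]
  · rintro _ ⟨m, a, ha, rfl⟩
    exact ⟨m, -1 * a, hleft _ ha, by rw [neg_one_mul, map_neg]⟩
  · ext x
    simp

end CStarLimit

/-! ### Simplicity forces density of the eigenvalues. -/

namespace DimensionDrop

/-- A nonnegative bump function around `z`, vanishing at the end points of the interval. -/
noncomputable def bump (z : unitInterval) (r : ℝ) : C(unitInterval, ℂ) :=
  ⟨fun s => ((max 0 (r - dist s z) * ((s : ℝ) * (1 - s)) : ℝ) : ℂ), by fun_prop⟩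

theorem bump_apply (z : unitInterval) (r : ℝ) (s : unitInterval) :
    bump z r s = ((max 0 (r - dist s z) * ((s : ℝ) * (1 - s)) : ℝ) : ℂ) := rfl

theorem bump_zero (z : unitInterval) (r : ℝ) : bump z r 0 = 0 := by simp [bump_apply]

theorem bump_one (z : unitInterval) (r : ℝ) : bump z r 1 = 0 := by simp [bump_apply]

theorem bump_eq_zero {z s : unitInterval} {r : ℝ} (h : r ≤ dist s z) : bump z r s = 0 := by
  rw [bump_apply, max_eq_left (by linarith)]
  simp

theorem exists_bump_ne_zero (z : unitInterval) {r : ℝ} (hr : 0 < r) : ∃ s, bump z r s ≠ 0 := by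
  obtain ⟨s, ⟨hs0, hs1⟩, hs⟩ := dense_Ioo_unitInterval.exists_dist_lt z hr
  refine ⟨s, ?_⟩
  rw [bump_apply, Ne, Complex.ofReal_eq_zero]
  have h0 : (0 : ℝ) < s := hs0
  have h1 : (s : ℝ) < 1 := hs1
  have h2 : 0 < max 0 (r - dist s z) := lt_max_of_lt_right (by rw [dist_comm]; linarith)
  have h3 : 0 < 1 - (s : ℝ) := by linarith
  positivity

theorem nontrivial_fiber {p q : ℕ} (hp : 0 < p) (hq : 0 < q) :
    Nontrivial (Matrix (Fin p × Fin q) (Fin p × Fin q) ℂ) := by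
  have : Nonempty (Fin p × Fin q) := ⟨(⟨0, hp⟩, ⟨0, hq⟩)⟩
  infer_instance

theorem scalar_eq_zero {p q : ℕ} (hp : 0 < p) (hq : 0 < q) {h : C(unitInterval, ℂ)}
    {s : unitInterval} (hs : (scalar (p := p) (q := q) h).1 s = 0) : h s = 0 := by
  have := nontrivial_fiber hp hq
  rw [scalar_apply] at hs
  exact (smul_eq_zero.1 hs).resolve_right one_ne_zero

section Limit

variable {p q : ℕ → ℕ}
  (ι : ∀ m n : ℕ, m ≤ n → dimensionDrop (p m) (q m) →⋆ₐ[ℂ] dimensionDrop (p n) (q n))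
  [DirectedSystem (fun n => dimensionDrop (p n) (q n)) (ι · · ·)]

/-- The limit of a system of dimension drop algebras has the closed ideal of elements that
vanish asymptotically along a sequence of points. -/
theorem exists_ideal_of_seq (N : ℕ → ℕ) (x : ℕ → unitInterval) :
    ∃ I : TwoSidedIdeal (CStarLimit (fun n => dimensionDrop (p n) (q n)) ι),
      (I : Set (CStarLimit (fun n => dimensionDrop (p n) (q n)) ι)) =
        closure {b | ∃ (m : ℕ) (a : dimensionDrop (p m) (q m)),
          (∀ᶠ j in Filter.atTop, ∀ h : m ≤ N j, (ι m (N j) h a).1 (x j) = 0) ∧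
            CStarLimit.of (A := fun n => dimensionDrop (p n) (q n)) ι m a = b} := by
  refine CStarLimit.exists_ideal (A := fun n => dimensionDrop (p n) (q n)) ι (S := fun m a =>
    ∀ᶠ j in Filter.atTop, ∀ h : m ≤ N j, (ι m (N j) h a).1 (x j) = 0) ?_ ?_ ?_ ?_ ?_
  · intro m
    refine Filter.Eventually.of_forall fun j h => ?_
    rw [show ι m (N j) h 0 = 0 from map_zero (ι m (N j) h), coe_zero]
  · intro m a b ha hb
    filter_upwards [ha, hb] with j ha hb h
    rw [show ι m (N j) h (a + b) = ι m (N j) h a + ι m (N j) h b from map_add (ι m (N j) h) a b,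
      coe_add, ha, hb, add_zero]
  · intro m a b ha
    filter_upwards [ha] with j ha h
    rw [show ι m (N j) h (b * a) = ι m (N j) h b * ι m (N j) h a from map_mul (ι m (N j) h) b a,
      coe_mul, ha, mul_zero]
  · intro m a b ha
    filter_upwards [ha] with j ha h
    rw [show ι m (N j) h (a * b) = ι m (N j) h a * ι m (N j) h b from map_mul (ι m (N j) h) a b,
      coe_mul, ha, zero_mul]
  · intro m a n h ha
    filter_upwards [ha] with j ha h'
    have : ι n (N j) h' (ι m n h a) = ι m (N j) (h.trans h') a :=
      DirectedSystem.map_map (f := (ι · · ·)) h h' a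
    rw [this]
    exact ha _

theorem hausdorffDist_lt_of_isSimple (hp : ∀ n, 0 < p n) (hq : ∀ n, 0 < q n)
    (hι : ∀ m n h, Function.Injective (ι m n h)) {k : ℕ → ℕ → ℕ}
    {t : ∀ m n : ℕ, Fin (k m n) → C(unitInterval, unitInterval)}
    (ht : ∀ (m n : ℕ) (h : m ≤ n), IsEigenvaluePattern (ι m n h) (t m n))
    (hs : IsSimpleCStarAlgebra (CStarLimit (fun n => dimensionDrop (p n) (q n)) ι))
    {ε : ℝ} (hε : 0 < ε) (y : unitInterval) (m : ℕ) : ∃ n : ℕ, m < n ∧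
      ∀ x : unitInterval, (∃ i, t m n i x = y) →
        Metric.hausdorffDist (Set.range fun i => t m n i x) Set.univ < ε := by
  by_contra! H
  have H' (j : ℕ) : ∃ x z : unitInterval, ∀ i, ε / 2 < dist (t m (m + 1 + j) i x) z := by
    obtain ⟨x, -, hx⟩ := H (m + 1 + j) (by omega)
    refine ⟨x, ?_⟩
    by_contra! hz
    have : Metric.hausdorffDist (Set.range fun i => t m (m + 1 + j) i x) Set.univ ≤ ε / 2 := by
      refine Metric.hausdorffDist_le_of_mem_dist (by positivity)
        (fun a _ => ⟨a, Set.mem_univ a, by simp; positivity⟩) fun z _ => ?_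
      obtain ⟨i, hi⟩ := hz z
      exact ⟨_, ⟨i, rfl⟩, by rwa [dist_comm]⟩
    linarith
  choose x z hxz using H'
  -- One bump has to work for infinitely many stages, so the gap centres must converge. Once they
  -- are within `ε / 4` of `z₀`, the ball of radius `ε / 4` about `z₀` contains no eigenvalue.
  obtain ⟨z₀, -, σ, hσ, hz⟩ := isCompact_univ.tendsto_subseq (x := z) fun _ => Set.mem_univ _
  obtain ⟨I, hI⟩ := exists_ideal_of_seq ι (fun j => m + 1 + σ j) (x ∘ σ)
  have hmem : CStarLimit.of (A := fun n => dimensionDrop (p n) (q n)) ι m (scalar (bump z₀ (ε / 4))) ∈ I := by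
    rw [← SetLike.mem_coe, hI]
    refine subset_closure ⟨m, _, ?_, rfl⟩
    filter_upwards [hz (Metric.ball_mem_nhds z₀ (show 0 < ε / 4 by positivity))] with j hj h
    refine map_apply_eq_zero (ht _ _ _) ?_ ?_ fun i => ?_
    · simp [bump_zero]
    · simp [bump_one]
    · rw [scalar_apply, bump_eq_zero, zero_smul]
      have h1 := hxz (σ j) i
      have h2 : dist (z (σ j)) z₀ < ε / 4 := hj
      have h3 := dist_triangle_right (t m (m + 1 + σ j) i (x (σ j))) (z (σ j)) z₀
      simp only [Function.comp_apply]
      linarith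
  have hcl : IsClosed (I : Set (CStarLimit (fun n => dimensionDrop (p n) (q n)) ι)) := by
    rw [hI]
    exact isClosed_closure
  rcases hs.2 I hcl with hbot | htop
  · rw [hbot, TwoSidedIdeal.mem_bot] at hmem
    have h1 := CStarLimit.norm_of (A := fun n => dimensionDrop (p n) (q n)) ι hι m (scalar (bump z₀ (ε / 4)))
    rw [hmem, norm_zero] at h1
    obtain ⟨s, hs⟩ := exists_bump_ne_zero z₀ (show 0 < ε / 4 by positivity)
    refine hs (scalar_eq_zero (hp m) (hq m) (s := s) (norm_le_zero_iff.1 ?_))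
    exact (norm_apply_le _ s).trans h1.symm.le
  -- An element `a` that eventually vanishes at the chosen points satisfies `‖1 - a‖ ≥ 1`, since
  -- evaluation there sends `1 - a` to `1`. Hence `1` is not in the closure.
  · have h1 : (1 : CStarLimit (fun n => dimensionDrop (p n) (q n)) ι) ∈ (I : Set _) := by
      rw [htop]
      trivial
    rw [hI, Metric.mem_closure_iff] at h1
    obtain ⟨_, ⟨l, a, ha, rfl⟩, hla⟩ := h1 1 one_pos
    rw [dist_eq_norm, ← map_one (CStarLimit.of (A := fun n => dimensionDrop (p n) (q n)) ι l), ← map_sub, CStarLimit.norm_of (A := fun n => dimensionDrop (p n) (q n)) ι hι] at hla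
    obtain ⟨j, hj, hlj⟩ := (ha.and (Filter.eventually_ge_atTop l)).exists
    have hlj' : l ≤ m + 1 + σ j := by have := hσ.id_le j; simp only [id] at this; omega
    have h2 := hj hlj'
    have := nontrivial_fiber (hp (m + 1 + σ j)) (hq (m + 1 + σ j))
    have h3 : ((ι l _ hlj') (1 - a)).1 ((x ∘ σ) j) = 1 := by
      rw [map_sub', coe_sub, h2, sub_zero, map_one, coe_one]
    have h4 : ‖((ι l _ hlj') (1 - a)).1 ((x ∘ σ) j)‖ ≤ ‖1 - a‖ :=
      norm_hom_le ((evalAt ((x ∘ σ) j)).comp (ι l _ hlj')) (1 - a)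
    rw [h3, CStarRing.norm_one] at h4
    exact absurd hla (not_lt.2 h4)

end Limit

end DimensionDrop

/-! ### Closed ideals of a dimension drop algebra and a trace estimate. -/

namespace DimensionDrop

section Ideal

variable {p q : ℕ}

theorem sum_mem_of_add_mem {M ι : Type*} [AddCommMonoid M] {I : Set M} (h0 : 0 ∈ I)
    (hadd : ∀ {a b}, a ∈ I → b ∈ I → a + b ∈ I) (S : Finset ι) {f : ι → M}
    (hf : ∀ i ∈ S, f i ∈ I) : ∑ i ∈ S, f i ∈ I :=
  Finset.sum_induction f (· ∈ I) (fun _ _ => hadd) h0 hf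

/-- Full matrix algebras are simple: a nonzero entry of `X f` is moved to any position by lifted
matrix units on both sides. -/
theorem exists_mem_map_eq {J : Type*} [Fintype J] [DecidableEq J] {I : Set (dimensionDrop p q)}
    (h0 : 0 ∈ I) (hadd : ∀ {a b}, a ∈ I → b ∈ I → a + b ∈ I)
    (hleft : ∀ {a} b, a ∈ I → b * a ∈ I) (hright : ∀ {a} b, a ∈ I → a * b ∈ I)
    (X : dimensionDrop p q →⋆ₐ[ℂ] Matrix J J ℂ) (hX : Function.Surjective X)
    {f : dimensionDrop p q} (hf : f ∈ I) (hXf : X f ≠ 0) (M : Matrix J J ℂ) :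
    ∃ g ∈ I, X g = M := by
  obtain ⟨i₀, j₀, hij⟩ : ∃ i j, X f i j ≠ 0 := by
    by_contra! H
    exact hXf (Matrix.ext H)
  choose G hG using fun i j : J => hX (Matrix.single i i₀ (M i j * (X f i₀ j₀)⁻¹))
  choose E hE using fun j : J => hX (Matrix.single j₀ j 1)
  refine ⟨∑ i, ∑ j, G i j * f * E j, ?_, ?_⟩
  · exact sum_mem_of_add_mem h0 hadd _ fun i _ => sum_mem_of_add_mem h0 hadd _ fun j _ =>
      hright _ (hleft _ hf)
  · simp only [map_sum, map_mul, hG, hE, Matrix.single_mul_mul_single, mul_one]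
    conv_rhs => rw [Matrix.matrix_eq_sum_single M]
    refine Finset.sum_congr rfl fun i _ => Finset.sum_congr rfl fun j _ => ?_
    rw [mul_assoc, inv_mul_cancel₀ hij, mul_one]

theorem exists_mem_apply_eq (hp : 0 < p) (hq : 0 < q) {I : Set (dimensionDrop p q)}
    (h0 : 0 ∈ I) (hadd : ∀ {a b}, a ∈ I → b ∈ I → a + b ∈ I)
    (hleft : ∀ {a} b, a ∈ I → b * a ∈ I) (hright : ∀ {a} b, a ∈ I → a * b ∈ I)
    (g : dimensionDrop p q) (x : unitInterval) (hg : (∀ f ∈ I, f.1 x = 0) → g.1 x = 0) :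
    ∃ f ∈ I, f.1 x = g.1 x := by
  by_cases H : ∀ f ∈ I, f.1 x = 0
  · exact ⟨0, h0, by rw [hg H, coe_zero]⟩
  push Not at H
  obtain ⟨f, hf, hfx⟩ := H
  by_cases hx0 : x = 0
  · subst hx0
    obtain ⟨f', hf', h⟩ := exists_mem_map_eq h0 hadd hleft hright (evalLeft hq)
      (evalLeft_surjective hq) hf (fun h => hfx ((evalLeft_eq_zero hq f).1 h)) (evalLeft hq g)
    refine ⟨f', hf', ?_⟩
    rw [evalLeft_apply, evalLeft_apply] at h
    rw [apply_zero_eq hq f', h, ← apply_zero_eq hq]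
  by_cases hx1 : x = 1
  · subst hx1
    obtain ⟨f', hf', h⟩ := exists_mem_map_eq h0 hadd hleft hright (evalRight hp)
      (evalRight_surjective hp) hf (fun h => hfx ((evalRight_eq_zero hp f).1 h)) (evalRight hp g)
    refine ⟨f', hf', ?_⟩
    rw [evalRight_apply, evalRight_apply] at h
    rw [apply_one_eq hp f', h, ← apply_one_eq hp]
  exact exists_mem_map_eq h0 hadd hleft hright (evalAt x) (evalAt_surjective hx0 hx1) hf hfx _

/-- A closed ideal of a dimension drop algebra contains every element vanishing on its hull. -/
theorem mem_of_forall_apply_eq_zero (hp : 0 < p) (hq : 0 < q) {I : Set (dimensionDrop p q)}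
    (hI : IsClosed I) (h0 : 0 ∈ I) (hadd : ∀ {a b}, a ∈ I → b ∈ I → a + b ∈ I)
    (hleft : ∀ {a} b, a ∈ I → b * a ∈ I) (hright : ∀ {a} b, a ∈ I → a * b ∈ I)
    {g : dimensionDrop p q} (hg : ∀ x, (∀ f ∈ I, f.1 x = 0) → g.1 x = 0) : g ∈ I := by
  rw [← hI.closure_eq, Metric.mem_closure_iff]
  intro ε hε
  choose F hF hFg using fun x => exists_mem_apply_eq hp hq h0 hadd hleft hright g x (hg x)
  set U : unitInterval → Set unitInterval := fun x => {z | ‖g.1 z - (F x).1 z‖ < ε / 2} with hU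
  have hUo (x) : IsOpen (U x) :=
    isOpen_lt ((map_continuous g.1).sub (map_continuous (F x).1)).norm continuous_const
  obtain ⟨T, hT⟩ := isCompact_univ.elim_finite_subcover U hUo fun x _ =>
    Set.mem_iUnion.2 ⟨x, by simp [hU, hFg, hε]⟩
  -- Elements of `I` agreeing with `g` at one point approximate it nearby; multiplication by scalar
  -- functions stays in `I`, so a partition of unity glues them.
  obtain ⟨ρ, hρ⟩ := PartitionOfUnity.exists_isSubordinate (isClosed_univ (X := unitInterval))
    (fun i : T => U i) (fun i => hUo i) fun x hx => by
      obtain ⟨i, hi, hxi⟩ := Set.mem_iUnion₂.1 (hT hx)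
      exact Set.mem_iUnion.2 ⟨⟨i, hi⟩, hxi⟩
  have hsum (z : unitInterval) : ∑ i, ρ i z = 1 := by
    rw [← finsum_eq_sum_of_fintype]
    exact ρ.sum_eq_one (Set.mem_univ z)
  refine ⟨∑ i : T, scalar ⟨fun z => (ρ i z : ℂ), by fun_prop⟩ * F i,
    sum_mem_of_add_mem h0 hadd _ fun i _ => hleft _ (hF i), ?_⟩
  refine (dist_eq_norm g _).trans_lt (lt_of_le_of_lt (norm_le (by positivity) fun z => ?_)
    (half_lt_self hε))
  have h1 : (g - ∑ i : T, scalar ⟨fun z => (ρ i z : ℂ), by fun_prop⟩ * F i).1 z =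
      ∑ i : T, (ρ i z : ℂ) • (g.1 z - (F i).1 z) := by
    rw [coe_sub, coe_sum]
    simp only [smul_sub, Finset.sum_sub_distrib, ← Finset.sum_smul]
    rw [← Complex.ofReal_sum, hsum, Complex.ofReal_one, one_smul]
    simp
  rw [h1]
  calc ‖∑ i : T, (ρ i z : ℂ) • (g.1 z - (F i).1 z)‖
      ≤ ∑ i : T, ρ i z * (ε / 2) := by
        refine (norm_sum_le _ _).trans (Finset.sum_le_sum fun i _ => ?_)
        rw [norm_smul, Complex.norm_real, Real.norm_of_nonneg (ρ.nonneg i z)]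
        by_cases hz : ρ i z = 0
        · simp [hz]
        · have : z ∈ U i := hρ i (subset_tsupport _ hz)
          exact mul_le_mul_of_nonneg_left (le_of_lt this) (ρ.nonneg i z)
    _ = ε / 2 := by rw [← Finset.sum_mul, hsum, one_mul]

end Ideal

section Trace

variable {p q p' q' p'' q'' k k' : ℕ} {φ : dimensionDrop p q →⋆ₐ[ℂ] dimensionDrop p' q'}
  {t : Fin k → C(unitInterval, unitInterval)} {ψ : dimensionDrop p' q' →⋆ₐ[ℂ] dimensionDrop p'' q''}
  {u : Fin k' → C(unitInterval, unitInterval)}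

theorem re_natCast_mul (n : ℕ) (z : ℂ) : ((n : ℂ) * z).re = n * z.re := by
  simp

/-- A real function as an element of the dimension drop algebra. -/
noncomputable def realScalar (h : C(unitInterval, ℝ)) : dimensionDrop p q :=
  scalar ⟨fun s => (h s : ℂ), by fun_prop⟩

theorem exists_trace_realScalar (hp : 0 < p) (hq : 0 < q) (ht : IsEigenvaluePattern φ t) :
    ∃ a b : ℕ, a < q ∧ b < p ∧ ∀ (h : C(unitInterval, ℝ)) (s : unitInterval),
      ((φ (realScalar h)).1 s).trace =
        ((p * a * h 0 + (p * q * ∑ i, h (t i s) + q * b * h 1) : ℝ) : ℂ) := by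
  obtain ⟨a, b, ha, hb, -, htr⟩ := exists_trace_eq ht
  refine ⟨a, b, ha, hb, fun h s => ?_⟩
  rw [htr]
  simp only [realScalar, scalar_apply, leftFactor_smul, rightFactor_smul, leftFactor_one hq,
    rightFactor_one hp, Matrix.trace_smul, Matrix.trace_one, Fintype.card_fin, Fintype.card_prod,
    smul_eq_mul, ← Finset.sum_mul, ContinuousMap.coe_mk]
  push_cast
  ring

/-- If `h` takes the value `1` at all eigenvalues, then its trace is at least that of one full
block. -/
theorem le_trace_comp (hp : 0 < p) (hq : 0 < q) (hp' : 0 < p') (hq' : 0 < q')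
    (ht : IsEigenvaluePattern φ t)
    (hu : IsEigenvaluePattern ψ u) (hk : 0 < k) (hk' : 0 < k') {h : C(unitInterval, ℝ)}
    (hh : ∀ s, 0 ≤ h s) {x : unitInterval} (hx : ∀ i j, h (t i (u j x)) = 1) :
    (p * q : ℝ) ≤ ((ψ (φ (realScalar h))).1 x).trace.re := by
  obtain ⟨a, b, -, -, htr⟩ := exists_trace_realScalar hp hq ht
  obtain ⟨a', b', -, -, -, htr'⟩ := exists_trace_eq hu
  set G := φ (realScalar h) with hG
  have hnn (s) : 0 ≤ (G.1 s).trace.re := by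
    rw [htr, Complex.ofReal_re]
    have h0 := hh 0
    have h1 := hh 1
    have h2 : 0 ≤ ∑ i, h (t i s) := Finset.sum_nonneg fun i _ => hh _
    positivity
  -- The end blocks of `ψ` contribute nonnegatively, since their traces are positive multiples of
  -- the traces of `G` at `0` and `1`.
  have hl : 0 ≤ (leftFactor (G.1 0)).trace.re := by
    have := hnn 0
    rw [apply_zero_eq hq', Matrix.trace_kronecker, Matrix.trace_one, Fintype.card_fin, mul_comm,
      re_natCast_mul] at this
    have hq0 : (0 : ℝ) < q' := by exact_mod_cast hq'
    exact nonneg_of_mul_nonneg_right this hq0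
  have hr : 0 ≤ (rightFactor (G.1 1)).trace.re := by
    have := hnn 1
    rw [apply_one_eq hp', Matrix.trace_kronecker, Matrix.trace_one, Fintype.card_fin,
      re_natCast_mul] at this
    have hp0 : (0 : ℝ) < p' := by exact_mod_cast hp'
    exact nonneg_of_mul_nonneg_right this hp0
  have hblock (j) : (p * q : ℝ) ≤ (G.1 (u j x)).trace.re := by
    rw [htr, Complex.ofReal_re]
    simp only [hx, Finset.sum_const, Finset.card_univ, Fintype.card_fin, nsmul_eq_mul, mul_one]
    have h0 := hh 0
    have h1 := hh 1
    have hk1 : (1 : ℝ) ≤ k := by exact_mod_cast hk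
    have h2 : (p * q : ℝ) * 1 ≤ p * q * k := by gcongr
    have h3 : 0 ≤ (p * a * h 0 : ℝ) := by positivity
    have h4 : 0 ≤ (q * b * h 1 : ℝ) := by positivity
    linarith
  rw [htr', Complex.add_re, Complex.add_re, re_natCast_mul, re_natCast_mul,
    Complex.re_sum]
  have h1 := hblock ⟨0, hk'⟩
  have h2 := Finset.single_le_sum (f := fun j => (G.1 (u j x)).trace.re)
    (fun j _ => hnn _) (Finset.mem_univ (⟨0, hk'⟩ : Fin k'))
  have h3 : 0 ≤ a' * (leftFactor (G.1 0)).trace.re := by positivity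
  have h4 : 0 ≤ b' * (rightFactor (G.1 1)).trace.re := by positivity
  linarith

end Trace

end DimensionDrop

/-! ### Density of the eigenvalues forces simplicity. -/

namespace DimensionDrop

section Simple

/-- The index `i₀` makes the range nonempty; for an empty range the real-valued distance would take
its default value `0`. -/
theorem exists_dist_lt_of_hausdorffDist_univ {k : ℕ} (u : Fin k → unitInterval) (i₀ : Fin k) {ε : ℝ}
    (h : Metric.hausdorffDist (Set.range u) Set.univ < ε) (z : unitInterval) :
    ∃ i, dist (u i) z < ε := by
  obtain ⟨_, ⟨i, rfl⟩, hi⟩ := Metric.exists_dist_lt_of_hausdorffDist_lt' (Set.mem_univ z) h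
    (Metric.hausdorffEDist_ne_top_of_nonempty_of_bounded ⟨_, i₀, rfl⟩ ⟨0, trivial⟩
      (Metric.isBounded_of_compactSpace) (Metric.isBounded_of_compactSpace))
  exact ⟨i, hi⟩

variable {p q : ℕ → ℕ}
  (ι : ∀ m n : ℕ, m ≤ n → dimensionDrop (p m) (q m) →⋆ₐ[ℂ] dimensionDrop (p n) (q n))
  [DirectedSystem (fun n => dimensionDrop (p n) (q n)) (ι · · ·)]

theorem of_mul (n : ℕ) (a b : dimensionDrop (p n) (q n)) :
    CStarLimit.of (A := fun n => dimensionDrop (p n) (q n)) ι n (a * b) =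
      CStarLimit.of (A := fun n => dimensionDrop (p n) (q n)) ι n a *
        CStarLimit.of (A := fun n => dimensionDrop (p n) (q n)) ι n b :=
  (CStarLimit.of (A := fun n => dimensionDrop (p n) (q n)) ι n).map_mul' a b

/-- The hull of an ideal of the inductive limit at the stage `n`. -/
def hull (I : TwoSidedIdeal (CStarLimit (fun n => dimensionDrop (p n) (q n)) ι)) (n : ℕ) :
    Set unitInterval :=
  {x | ∀ f, CStarLimit.of (A := fun n => dimensionDrop (p n) (q n)) ι n f ∈ I → f.1 x = 0}

variable {ι} {I : TwoSidedIdeal (CStarLimit (fun n => dimensionDrop (p n) (q n)) ι)}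

theorem isClosed_hull (n : ℕ) : IsClosed (hull ι I n) := by
  have : hull ι I n = ⋂ (f : dimensionDrop (p n) (q n))
      (_ : CStarLimit.of (A := fun n => dimensionDrop (p n) (q n)) ι n f ∈ I),
        {x | f.1 x = 0} := by
    ext x
    simp [hull]
  rw [this]
  exact isClosed_biInter fun f _ => isClosed_eq (map_continuous f.1) continuous_const

theorem of_mem_of_forall_hull (hp : ∀ n, 0 < p n) (hq : ∀ n, 0 < q n)
    (hι : ∀ m n h, Function.Injective (ι m n h))
    (hI : IsClosed (I : Set (CStarLimit (fun n => dimensionDrop (p n) (q n)) ι))) (n : ℕ)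
    {g : dimensionDrop (p n) (q n)} (hg : ∀ x ∈ hull ι I n, g.1 x = 0) :
    CStarLimit.of (A := fun n => dimensionDrop (p n) (q n)) ι n g ∈ I := by
  have hI' := CStarLimit.isClosed_preimage_of (A := fun n => dimensionDrop (p n) (q n)) ι hι n hI
  exact mem_of_forall_apply_eq_zero (hp n) (hq n)
    (I := {f | CStarLimit.of (A := fun n => dimensionDrop (p n) (q n)) ι n f ∈ I}) hI'
    (CStarLimit.of_zero_mem (A := fun n => dimensionDrop (p n) (q n)) ι I n)
    (fun ha hb => CStarLimit.of_add_mem (A := fun n => dimensionDrop (p n) (q n)) ι ha hb)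
    (fun b ha => by
      rw [Set.mem_ofPred_eq, of_mul]
      exact I.mul_mem_left _ _ ha)
    (fun b ha => by
      rw [Set.mem_ofPred_eq, of_mul]
      exact I.mul_mem_right _ _ ha) hg

theorem of_map_mem {m n : ℕ} (h : m ≤ n) {f : dimensionDrop (p m) (q m)} :
    CStarLimit.of (A := fun n => dimensionDrop (p n) (q n)) ι n (ι m n h f) ∈ I ↔
      CStarLimit.of (A := fun n => dimensionDrop (p n) (q n)) ι m f ∈ I := by
  rw [CStarLimit.of_map (A := fun n => dimensionDrop (p n) (q n)) ι m n h f]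

theorem hull_nonempty (hp : ∀ n, 0 < p n) (hq : ∀ n, 0 < q n)
    (hι : ∀ m n h, Function.Injective (ι m n h))
    (hI : IsClosed (I : Set (CStarLimit (fun n => dimensionDrop (p n) (q n)) ι))) (hI1 : I ≠ ⊤)
    (n : ℕ) : (hull ι I n).Nonempty := by
  by_contra! H
  apply hI1
  have h1 := of_mem_of_forall_hull hp hq hι hI n (g := 1) (by simp [H])
  have h2 : CStarLimit.of (A := fun n => dimensionDrop (p n) (q n)) ι n 1 = 1 := map_one _
  rw [h2] at h1
  exact (TwoSidedIdeal.one_mem_iff I).1 h1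

variable {k : ℕ → ℕ → ℕ} {t : ∀ m n : ℕ, Fin (k m n) → C(unitInterval, unitInterval)}

theorem pattern_mem_hull
    (ht : ∀ (m n : ℕ) (h : m ≤ n), IsEigenvaluePattern (ι m n h) (t m n)) {m n : ℕ} (h : m ≤ n)
    {x : unitInterval} (hx : x ∈ hull ι I n) (i : Fin (k m n)) : t m n i x ∈ hull ι I m :=
  fun _ hf => apply_pattern_eq_zero (ht m n h) (hx _ ((of_map_mem h).2 hf)) i

theorem exists_pattern_eq_of_mem_hull (hp : ∀ n, 0 < p n) (hq : ∀ n, 0 < q n)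
    (hι : ∀ m n h, Function.Injective (ι m n h))
    (ht : ∀ (m n : ℕ) (h : m ≤ n), IsEigenvaluePattern (ι m n h) (t m n))
    (hI : IsClosed (I : Set (CStarLimit (fun n => dimensionDrop (p n) (q n)) ι)))
    {m n : ℕ} (h : m ≤ n) {y : unitInterval} (hy : y ∈ hull ι I m) (hy0 : y ≠ 0) (hy1 : y ≠ 1) :
    ∃ x ∈ hull ι I n, ∃ i, t m n i x = y := by
  by_contra! H
  -- A function vanishing on `K` has image vanishing on the later hull, hence lies in the ideal. One
  -- that equals `1` at `y` would then contradict `y` being in the hull. The end points are in `K`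
  -- to annihilate the end blocks.
  set K : Set unitInterval := {0, 1} ∪ ⋃ i, t m n i '' hull ι I n with hK
  have hKc : IsClosed K := ((Set.toFinite {0, 1}).isClosed).union
    (isClosed_iUnion_of_finite fun i =>
      ((isClosed_hull n).isCompact.image (t m n i).continuous).isClosed)
  have hyK : y ∉ K := by
    simp only [hK, Set.mem_union, Set.mem_insert_iff, Set.mem_singleton_iff, Set.mem_iUnion,
      Set.mem_image, not_or, not_exists, not_and]
    exact ⟨⟨hy0, hy1⟩, fun i x hx => H x hx i⟩
  obtain ⟨g, hg0, hg1, -⟩ := exists_continuous_zero_one_of_isClosed hKc (isClosed_singleton (x := y))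
    (Set.disjoint_singleton_right.2 hyK)
  have hgK {x : unitInterval} (hx : x ∈ K) :
      (realScalar (p := p m) (q := q m) g).1 x = 0 := by
    simp [realScalar, hg0 hx]
  have h1 := (of_map_mem h).1 (of_mem_of_forall_hull hp hq hι hI n
    (g := ι m n h (realScalar g)) fun x hx => map_apply_eq_zero (ht m n h)
      (hgK (by simp [hK])) (hgK (by simp [hK]))
      fun i => hgK (Or.inr (Set.mem_iUnion.2 ⟨i, x, hx, rfl⟩)))
  have h2 := scalar_eq_zero (hp m) (hq m) (hy _ h1)
  simp [hg1 (Set.mem_singleton y)] at h2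

theorem hull_eq_univ (hp : ∀ n, 0 < p n) (hq : ∀ n, 0 < q n)
    (hι : ∀ m n h, Function.Injective (ι m n h))
    (ht : ∀ (m n : ℕ) (h : m ≤ n), IsEigenvaluePattern (ι m n h) (t m n))
    (hcond : ∀ ε : ℝ, 0 < ε → ∀ (y : unitInterval) (m : ℕ), ∃ n : ℕ, m < n ∧
      ∀ x : unitInterval, (∃ i, t m n i x = y) →
        Metric.hausdorffDist (Set.range fun i => t m n i x) Set.univ < ε)
    (hI : IsClosed (I : Set (CStarLimit (fun n => dimensionDrop (p n) (q n)) ι)))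
    {m : ℕ} {y : unitInterval} (hy : y ∈ hull ι I m) (hy0 : y ≠ 0) (hy1 : y ≠ 1) :
    hull ι I m = Set.univ := by
  rw [← (isClosed_hull m).closure_eq, ← dense_iff_closure_eq, Metric.dense_iff]
  intro z r hr
  obtain ⟨n, hmn, hn⟩ := hcond r hr y m
  obtain ⟨x, hx, i, hi⟩ := exists_pattern_eq_of_mem_hull hp hq hι ht hI hmn.le hy hy0 hy1
  obtain ⟨j, hj⟩ := exists_dist_lt_of_hausdorffDist_univ (fun i => t m n i x) i (hn x ⟨i, hi⟩) z
  exact ⟨_, hj, pattern_mem_hull ht hmn.le hx j⟩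

theorem isSimple_of_hausdorffDist_lt (hp : ∀ n, 0 < p n) (hq : ∀ n, 0 < q n)
    (hι : ∀ m n h, Function.Injective (ι m n h))
    (ht : ∀ (m n : ℕ) (h : m ≤ n), IsEigenvaluePattern (ι m n h) (t m n))
    (hcond : ∀ ε : ℝ, 0 < ε → ∀ (y : unitInterval) (m : ℕ), ∃ n : ℕ, m < n ∧
      ∀ x : unitInterval, (∃ i, t m n i x = y) →
        Metric.hausdorffDist (Set.range fun i => t m n i x) Set.univ < ε) :
    IsSimpleCStarAlgebra (CStarLimit (fun n => dimensionDrop (p n) (q n)) ι) := by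
  constructor
  · refine nontrivial_of_ne (CStarLimit.of (A := fun n => dimensionDrop (p n) (q n)) ι 0 1) 0 ?_
    intro h
    have h1 := CStarLimit.norm_of (A := fun n => dimensionDrop (p n) (q n)) ι hι 0 1
    rw [h, norm_zero] at h1
    have h2 : ‖(1 : dimensionDrop (p 0) (q 0)).1 0‖ ≤ 0 :=
      (norm_apply_le (1 : dimensionDrop (p 0) (q 0)) 0).trans h1.symm.le
    have := nontrivial_fiber (hp 0) (hq 0)
    rw [coe_one, CStarRing.norm_one] at h2
    linarith
  intro I hI
  by_contra! hne
  obtain ⟨hbot, htop⟩ := hne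
  obtain ⟨m, a, ha, ha0⟩ := CStarLimit.exists_of_mem
    (A := fun n => dimensionDrop (p n) (q n)) ι hI hbot
  -- An interior hull point would make the hull everything, and then the nonzero element `a` of the
  -- ideal would vanish at stage `n`.
  have hend {n : ℕ} (hmn : m ≤ n) {y : unitInterval} (hy : y ∈ hull ι I n) : y = 0 ∨ y = 1 := by
    by_contra! hy01
    have huniv := hull_eq_univ hp hq hι ht hcond hI hy hy01.1 hy01.2
    have h0 : ι m n hmn a = 0 := ext' fun s => by
      have : s ∈ hull ι I n := by rw [huniv]; trivial
      exact this _ ((of_map_mem hmn).2 ha)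
    apply ha0
    rw [← CStarLimit.of_map (A := fun n => dimensionDrop (p n) (q n)) ι m n hmn a, h0]
    exact map_zero (CStarLimit.of (A := fun n => dimensionDrop (p n) (q n)) ι n)
  -- If `y` occurred, some eigenvalue would be within `1/4` of `1/2`; but the eigenvalues over the
  -- hull lie in the hull at stage `m`, inside `{0,1}`.
  have hnot (y : unitInterval) (hy : y = 0 ∨ y = 1) : ∃ n, m < n ∧ ∀ x ∈ hull ι I n,
      ∀ i, t m n i x ≠ y := by
    obtain ⟨n, hmn, hn⟩ := hcond (1 / 4) (by norm_num) y m
    refine ⟨n, hmn, fun x hx i hi => ?_⟩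
    obtain ⟨j, hj⟩ := exists_dist_lt_of_hausdorffDist_univ (fun i => t m n i x) i
      (hn x ⟨i, hi⟩) ⟨1 / 2, by norm_num, by norm_num⟩
    rw [Subtype.dist_eq, Real.dist_eq] at hj
    rcases hend le_rfl (pattern_mem_hull ht hmn.le hx j) with h | h
    · rw [h] at hj
      norm_num [abs_of_nonneg] at hj
    · rw [h] at hj
      norm_num [abs_of_nonneg] at hj
  have hk (n n' : ℕ) (h : n ≤ n') : 0 < k n n' :=
    pos_of_injective (hp n) (hq n) (ht n n' h) (hι n n' h)
  have hcomp {n n' : ℕ} (h : m ≤ n) (h' : n ≤ n') (f) :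
      ι n n' h' (ι m n h f) = ι m n' (h.trans h') f :=
    DirectedSystem.map_map (f := (ι · · ·)) h h' f
  have hpm : (0 : ℝ) < p m := by exact_mod_cast hp m
  have hqm : (0 : ℝ) < q m := by exact_mod_cast hq m
  obtain ⟨n₀, hmn₀, h₀⟩ := hnot 0 (.inl rfl)
  obtain ⟨n₁, hmn₁, h₁⟩ := hnot 1 (.inr rfl)
  have h₀' {x} (hx : x ∈ hull ι I n₀) (i) : t m n₀ i x = 1 :=
    (hend le_rfl (pattern_mem_hull ht hmn₀.le hx i)).resolve_left (h₀ x hx i)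
  have h₁' {x} (hx : x ∈ hull ι I n₁) (i) : t m n₁ i x = 0 :=
    (hend le_rfl (pattern_mem_hull ht hmn₁.le hx i)).resolve_right (h₁ x hx i)
  rcases le_total n₀ n₁ with hle | hle
  -- Test with `h(s) = s` over a hull point of the later stage. Passing through `n₀`, all composed
  -- eigenvalues are `1` and the trace is at least `pq`. Directly, all eigenvalues are `0` and only
  -- the right end blocks remain, giving `q b' < pq`.
  · obtain ⟨x, hx⟩ := hull_nonempty hp hq hι hI htop n₁
    have h1 := le_trace_comp (hp m) (hq m) (hp n₀) (hq n₀) (ht m n₀ hmn₀.le) (ht n₀ n₁ hle)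
      (hk _ _ hmn₀.le) (hk _ _ hle) (h := ⟨fun s => (s : ℝ), by fun_prop⟩) (fun s => s.2.1)
      (x := x) fun i j => by simp [h₀' (pattern_mem_hull ht hle hx j) i]
    obtain ⟨a', b', -, hb', htr⟩ := exists_trace_realScalar (hp m) (hq m) (ht m n₁ hmn₁.le)
    rw [hcomp, htr, Complex.ofReal_re] at h1
    simp only [ContinuousMap.coe_mk, h₁' hx] at h1
    have hb : (b' : ℝ) < p m := by exact_mod_cast hb'
    simp at h1
    nlinarith
  -- Symmetric, with `h(s) = 1 - s` and the left end blocks, which give `p a' < pq`.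
  · obtain ⟨x, hx⟩ := hull_nonempty hp hq hι hI htop n₀
    have h1 := le_trace_comp (hp m) (hq m) (hp n₁) (hq n₁) (ht m n₁ hmn₁.le) (ht n₁ n₀ hle)
      (hk _ _ hmn₁.le) (hk _ _ hle) (h := ⟨fun s => 1 - (s : ℝ), by fun_prop⟩)
      (fun s => sub_nonneg.2 s.2.2)
      (x := x) fun i j => by simp [h₁' (pattern_mem_hull ht hle hx j) i]
    obtain ⟨a', b', ha', -, htr⟩ := exists_trace_realScalar (hp m) (hq m) (ht m n₀ hmn₀.le)
    rw [hcomp, htr, Complex.ofReal_re] at h1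
    simp only [ContinuousMap.coe_mk, h₀' hx] at h1
    have hb : (a' : ℝ) < q m := by exact_mod_cast ha'
    simp at h1
    nlinarith

end Simple

end DimensionDrop
theorem mainTheorem6 (p q : ℕ → ℕ) (hp : ∀ n, 0 < p n) (hq : ∀ n, 0 < q n)
    (hpq : ∀ n, Nat.Coprime (p n) (q n))
    (ι : ∀ m n : ℕ, m ≤ n → dimensionDrop (p m) (q m) →⋆ₐ[ℂ] dimensionDrop (p n) (q n))
    [DirectedSystem (fun n => dimensionDrop (p n) (q n)) (ι · · ·)]
    (hinj : ∀ (m n : ℕ) (h : m ≤ n), p m = 1 ∨ q m = 1 → Function.Injective (ι m n h)) :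
    (∀ (m n : ℕ) (h : m ≤ n), ∃ (k : ℕ) (t : Fin k → C(unitInterval, unitInterval)),
      IsNormalizedEigenvaluePattern (ι m n h) t) ∧
    ∀ (k : ℕ → ℕ → ℕ) (t : ∀ m n : ℕ, Fin (k m n) → C(unitInterval, unitInterval)),
      (∀ (m n : ℕ) (h : m ≤ n), IsNormalizedEigenvaluePattern (ι m n h) (t m n)) →
      (IsSimpleCStarAlgebra (CStarLimit (fun n => dimensionDrop (p n) (q n)) ι) ↔
        ∀ ε : ℝ, 0 < ε → ∀ (y : unitInterval) (m : ℕ), ∃ n : ℕ, m < n ∧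
          ∀ x : unitInterval, (∃ i, t m n i x = y) →
            Metric.hausdorffDist (Set.range fun i => t m n i x) Set.univ < ε) := by
  have hpat (m n : ℕ) (h : m ≤ n) : ∃ (k : ℕ) (t : Fin k → C(unitInterval, unitInterval)),
      IsNormalizedEigenvaluePattern (ι m n h) t :=
    DimensionDrop.exists_isNormalizedEigenvaluePattern (hp m) (hq m) (hpq m) _
  have hι (m n : ℕ) (h : m ≤ n) : Function.Injective (ι m n h) := by
    by_cases h1 : p m = 1 ∨ q m = 1
    · exact hinj m n h h1
    · obtain ⟨k, t, ht⟩ := hpat m n h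
      have := hp m
      have := hq m
      exact DimensionDrop.injective_of_one_lt (by omega) (by omega) (hp n) (hq n) (hpq n) ht.1
  refine ⟨hpat, fun k t ht => ⟨fun hs ε hε y m => ?_, fun hcond => ?_⟩⟩
  · exact DimensionDrop.hausdorffDist_lt_of_isSimple ι hp hq hι (fun m n h => (ht m n h).1) hs hε y m
  · exact DimensionDrop.isSimple_of_hausdorffDist_lt hp hq hι (fun m n h => (ht m n h).1) hcond
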